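/- Let $p\in L_\infty[0,1]$ be real with $p\ge c$ almost everywhere for some constant $c>0$. Let $q,r$ be real elements of $W_2^{-1}[0,1]$, the dual space of $W_2^1[0,1]$; the value of $q$ at $w\in W_2^1[0,1]$ is written $\int_0^1 q\,w\,dx$, and $q$ is real if this value is real for every real-valued $w$. Let $U$ be a diagonal unitary complex $2\times2$ matrix. For $y\in W_2^1[0,1]$ put $y^\wedge=(y(0),y(1))$. Let $$\mathfrak H_U=\{y\in W_2^1[0,1] : y^\wedge\in\operatorname{im}(U-1)\},\qquad \|y\|^2_{\mathfrak H_U}=\int_0^1\bigl(|y'|^2+|y|^2\bigr)\,dx .$$ Let $I:\mathfrak H_U\to L_2[0,1]$ be the embedding, let $\mathfrak H_U'$ be the completion of $L_2[0,1]$ in the norm $\|y\|_{\mathfrak H'_U}=\|I^*y\|_{\mathfrak H_U}$, and let $I^+:\mathfrak H_U'\to\mathfrak H_U$ be the isometry that extends $I^*$ by continuity. The linear operator pencil $T(\lambda):\mathfrak H_U\to\mathfrak H'_U$, $\lambda\in\mathbb C$, is defined by $$\langle I^+T(\lambda)y,y\rangle_{\mathfrak H_U}=\int_0^1 p\,|y'|^2\,dx+\int_0^1(q-\lambda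 r)\,|y|^2\,dx+\langle Vy^\wedge,y^\wedge\rangle_{\mathbb C^2}\qquad(y\in\mathfrak H_U),$$ where $V$ is the diagonal $2\times 2$ matrix with $V_{kk}=-\cot\bigl(\tfrac12\arg U_{kk}\bigr)$ if $U_{kk}\ne1$ and $V_{kk}=0$ if $U_{kk}=1$. (This is the operator form of the boundary problem $-(py')'+(q-\lambda r)y=0$, $(U-1)y^\vee+i(U+1)y^\wedge=0$, where $y^\vee=(y^{[1]}(0),-y^{[1]}(1))$ and $y^{[1]}$ is the quasi-derivative of $y$.) The spectrum of $T$ is the set of all $\lambda\in\mathbb C$ for which $T(\lambda)$ has no bounded inverse. An eigenvalue $\lambda$ is simple if $\dim\ker T(\lambda)=1$ and no eigenvector $y$ has an associated vector, that is, a vector $z$ with $T(\lambda)z+T'(\lambda)y=0$. A bounded Hermitian operator $E$ on a Hilbert space is positive if $\langle Ey,y\rangle>0$ for all $y\neq0$. Its index of inertia $\operatorname{ind}E$ is the supremum of the dimensions of the subspaces $M$ for which there is a $c>0$ with $\langle Ey,y\rangle\le-c\|y\|^2$ for all $y\in M$. Suppose that $I^+T(\xi)$ is positive for some $\xi\in\mathbb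 R$. Then the spectrum of $T$ is the set of terms of two sequences $\{\lambda_{-k}\}_{k\ge1}$ and $\{\lambda_k\}_{k\ge1}$ of simple real eigenvalues, $$\ldots<\lambda_{-2}<\lambda_{-1}<\xi<\lambda_1<\lambda_2<\ldots,$$ where each sequence may be finite or empty and has no finite accumulation point. Moreover, $\operatorname{ind}I^+T(\lambda_n)=|n|-1$ for every index $n\neq0$ that occurs. -/

import Mathlib

open MeasureTheory
open scoped ENNReal ComplexConjugate

noncomputable section

namespace SturmLiouville

/-- Lebesgue measure on `[0, 1]`. -/
abbrev μI : Measure ℝ := volume.restrict (Set.Icc (0 : ℝ) 1)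

/-- The complex Hilbert space `L₂[0, 1]`. -/
abbrev L2I : Type := Lp ℂ 2 μI

instance : IsProbabilityMeasure μI := ⟨by simp [μI]⟩

theorem integrable_L2 (g : L2I) : Integrable g μI :=
  (Lp.memLp g).integrable (by norm_num)

theorem integral_norm_le (g : L2I) : ∫ t, ‖g t‖ ∂μI ≤ ‖g‖ := by
  rw [integral_norm_eq_lintegral_enorm (Lp.aestronglyMeasurable g), Lp.norm_def]
  refine ENNReal.toReal_mono (Lp.eLpNorm_ne_top g) ?_
  rw [← eLpNorm_one_eq_lintegral_enorm]
  exact eLpNorm_le_eLpNorm_of_exponent_le (by norm_num) (Lp.aestronglyMeasurable g)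

theorem intervalIntegrable_L2 (g : L2I) : IntervalIntegrable g volume 0 1 := by
  rw [intervalIntegrable_iff_integrableOn_Icc_of_le zero_le_one]
  exact integrable_L2 g

theorem intervalIntegrable_L2' (g : L2I) {x : ℝ} (hx : x ∈ Set.Icc (0 : ℝ) 1) :
    IntervalIntegrable g volume 0 x :=
  (intervalIntegrable_L2 g).mono_set (by
    rw [Set.uIcc_of_le hx.1, Set.uIcc_of_le zero_le_one]
    exact Set.Icc_subset_Icc_right hx.2)

theorem integral_congr_L2 {f g : ℝ → ℂ} (h : f =ᵐ[μI] g) {x : ℝ}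
    (hx : x ∈ Set.Icc (0 : ℝ) 1) : ∫ t in (0 : ℝ)..x, f t = ∫ t in (0 : ℝ)..x, g t := by
  apply intervalIntegral.integral_congr_ae
  have := (ae_restrict_iff' measurableSet_Icc).1 h
  filter_upwards [this] with t ht htx
  rw [Set.uIoc_of_le hx.1] at htx
  exact ht ⟨htx.1.le, htx.2.trans hx.2⟩

theorem norm_integral_L2_le (g : L2I) {x : ℝ} (hx : x ∈ Set.Icc (0 : ℝ) 1) :
    ‖∫ t in (0 : ℝ)..x, g t‖ ≤ ‖g‖ := by
  refine le_trans ?_ (integral_norm_le g)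
  rw [intervalIntegral.integral_of_le hx.1]
  refine (norm_integral_le_integral_norm _).trans ?_
  refine setIntegral_mono_set (integrable_L2 g).norm (by filter_upwards with t; positivity) ?_
  exact (Set.Ioc_subset_Icc_self.trans (Set.Icc_subset_Icc_right hx.2)).eventuallyLE

theorem integral_add_L2 (f g : L2I) {x : ℝ} (hx : x ∈ Set.Icc (0 : ℝ) 1) :
    ∫ t in (0 : ℝ)..x, (f + g : L2I) t
      = (∫ t in (0 : ℝ)..x, f t) + ∫ t in (0 : ℝ)..x, g t := by
  rw [integral_congr_L2 (Lp.coeFn_add f g) hx]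
  exact intervalIntegral.integral_add (intervalIntegrable_L2' f hx) (intervalIntegrable_L2' g hx)

theorem integral_smul_L2 (a : ℂ) (f : L2I) {x : ℝ} (hx : x ∈ Set.Icc (0 : ℝ) 1) :
    ∫ t in (0 : ℝ)..x, (a • f : L2I) t = a * ∫ t in (0 : ℝ)..x, f t := by
  rw [integral_congr_L2 (Lp.coeFn_smul a f) hx]
  exact intervalIntegral.integral_smul a _

theorem continuousOn_primitive_L2 (g : L2I) :
    ContinuousOn (fun x => ∫ t in (0 : ℝ)..x, g t) (Set.Icc 0 1) := by
  have := intervalIntegral.continuousOn_primitive_interval (μ := volume) (f := g) (a := 0) (b := 1)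
    (by rw [Set.uIcc_of_le zero_le_one]; exact integrable_L2 g)
  rwa [Set.uIcc_of_le zero_le_one] at this

theorem ae_mem_Icc : ∀ᵐ x ∂μI, x ∈ Set.Icc (0 : ℝ) 1 :=
  ae_restrict_mem measurableSet_Icc

/-- The pairs `u = (y, y')` of functions of class `L₂[0, 1]` for which `y` has an absolutely
continuous representative with derivative `y'`. -/
def sobolevPairs : Submodule ℂ (WithLp 2 (L2I × L2I)) where
  carrier := {u | ∃ c : ℂ, ∀ᵐ x ∂μI, u.fst x = c + ∫ t in (0 : ℝ)..x, u.snd t}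
  zero_mem' := by
    refine ⟨0, ?_⟩
    have h0 := Lp.coeFn_zero ℂ 2 μI
    filter_upwards [h0, ae_mem_Icc] with x hx hx'
    have := integral_congr_L2 h0 hx'
    simp only [WithLp.zero_fst, WithLp.zero_snd]
    rw [this, hx]; simp
  add_mem' := by
    rintro u v ⟨c, hc⟩ ⟨d, hd⟩
    refine ⟨c + d, ?_⟩
    filter_upwards [hc, hd, Lp.coeFn_add u.fst v.fst, ae_mem_Icc] with x h1 h2 h3 hx
    simp only [WithLp.add_fst, WithLp.add_snd]
    rw [integral_add_L2 _ _ hx, h3, Pi.add_apply, h1, h2]; ring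
  smul_mem' := by
    rintro a u ⟨c, hc⟩
    refine ⟨a * c, ?_⟩
    filter_upwards [hc, Lp.coeFn_smul a u.fst, ae_mem_Icc] with x h1 h3 hx
    simp only [WithLp.smul_fst, WithLp.smul_snd]
    rw [integral_smul_L2 _ _ hx, h3, Pi.smul_apply, h1, smul_eq_mul]; ring

/-- The Sobolev space `W₂¹[0, 1]` of complex functions, realised as the space of all pairs
`(y, y')`. The norm is inherited from the `ℓ²`-product: `‖y‖² = ∫ |y|² + ∫ |y'|²`. -/
def W21 : Type := sobolevPairs

instance : NormedAddCommGroup W21 := inferInstanceAs (NormedAddCommGroup sobolevPairs)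

instance : InnerProductSpace ℂ W21 := inferInstanceAs (InnerProductSpace ℂ sobolevPairs)

/-- An element of `W₂¹[0, 1]` as the pair `(y, y')`. -/
def toPair : W21 →L[ℂ] WithLp 2 (L2I × L2I) := sobolevPairs.subtypeL

theorem toPair_mem (u : W21) : ∃ c : ℂ, ∀ᵐ x ∂μI,
    (toPair u).fst x = c + ∫ t in (0 : ℝ)..x, (toPair u).snd t := u.2

/-- The function `y` underlying `u ∈ W₂¹[0, 1]`, as an element of `L₂[0, 1]`. -/
def toL2 : W21 →L[ℂ] L2I := (WithLp.fstL 2 ℂ L2I L2I) ∘L toPair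

/-- The (weak) derivative `y'` of `u ∈ W₂¹[0, 1]`. -/
def D : W21 →L[ℂ] L2I := (WithLp.sndL 2 ℂ L2I L2I) ∘L toPair

theorem norm_sq_W21 (u : W21) : ‖u‖ ^ 2 = ‖toL2 u‖ ^ 2 + ‖D u‖ ^ 2 :=
  WithLp.prod_norm_sq_eq_of_L2 _

/-- The value at `x ∈ [0, 1]` of the continuous representative of `u ∈ W₂¹[0, 1]`. -/
def rep (u : W21) (x : ℝ) : ℂ := Classical.choose (toPair_mem u) + ∫ t in (0 : ℝ)..x, D u t

theorem toL2_ae (u : W21) : ∀ᵐ x ∂μI, toL2 u x = rep u x := Classical.choose_spec (toPair_mem u)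

theorem continuousOn_rep (u : W21) : ContinuousOn (rep u) (Set.Icc 0 1) :=
  continuousOn_const.add (continuousOn_primitive_L2 (D u))

theorem rep_eq (u : W21) (c : ℂ) (h : ∀ᵐ x ∂μI, toL2 u x = c + ∫ t in (0 : ℝ)..x, D u t) (x : ℝ) :
    rep u x = c + ∫ t in (0 : ℝ)..x, D u t := by
  obtain ⟨t, h1, h2⟩ := ((toL2_ae u).and h).exists
  rw [h1, rep] at h2
  rw [rep, add_right_cancel h2]

theorem rep_add (u v : W21) {x : ℝ} (hx : x ∈ Set.Icc (0 : ℝ) 1) :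
    rep (u + v) x = rep u x + rep v x := by
  rw [rep_eq (u + v) (Classical.choose (toPair_mem u) + Classical.choose (toPair_mem v)) ?_, map_add,
    integral_add_L2 _ _ hx, rep, rep]
  · ring
  · filter_upwards [toL2_ae u, toL2_ae v, Lp.coeFn_add (toL2 u) (toL2 v), ae_mem_Icc]
      with t h1 h2 h3 ht
    rw [map_add, map_add, integral_add_L2 _ _ ht, h3, Pi.add_apply, h1, h2, rep, rep]; ring

theorem rep_smul (a : ℂ) (u : W21) {x : ℝ} (hx : x ∈ Set.Icc (0 : ℝ) 1) :
    rep (a • u) x = a * rep u x := by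
  rw [rep_eq (a • u) (a * Classical.choose (toPair_mem u)) ?_, map_smul,
    integral_smul_L2 _ _ hx, rep]
  · ring
  · filter_upwards [toL2_ae u, Lp.coeFn_smul a (toL2 u), ae_mem_Icc] with t h1 h3 ht
    rw [map_smul, map_smul, integral_smul_L2 _ _ ht, h3, Pi.smul_apply, h1, smul_eq_mul, rep]; ring

theorem norm_toL2_le (u : W21) : ‖toL2 u‖ ≤ ‖u‖ := WithLp.norm_fst_le _ _

theorem norm_D_le (u : W21) : ‖D u‖ ≤ ‖u‖ := WithLp.norm_snd_le _ _

theorem norm_rep_le (u : W21) {x : ℝ} (hx : x ∈ Set.Icc (0 : ℝ) 1) : ‖rep u x‖ ≤ 3 * ‖u‖ := by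
  have hc : ‖Classical.choose (toPair_mem u)‖ ≤ 2 * ‖u‖ := by
    have h1 : ∀ᵐ t ∂μI, ‖Classical.choose (toPair_mem u)‖ ≤ ‖toL2 u t‖ + ‖u‖ := by
      filter_upwards [toL2_ae u, ae_mem_Icc] with t h1 ht
      have : Classical.choose (toPair_mem u) = toL2 u t - ∫ s in (0 : ℝ)..t, D u s := by
        rw [h1, rep]; ring
      calc _ = ‖toL2 u t - ∫ s in (0 : ℝ)..t, D u s‖ := by rw [← this]
        _ ≤ ‖toL2 u t‖ + ‖∫ s in (0 : ℝ)..t, D u s‖ := norm_sub_le _ _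
        _ ≤ _ := by gcongr; exact (norm_integral_L2_le _ ht).trans (norm_D_le u)
    have h2 := integral_mono_ae (integrable_const _)
      ((integrable_L2 (toL2 u)).norm.add (integrable_const ‖u‖)) h1
    simp only [Pi.add_apply] at h2
    rw [integral_add (integrable_L2 (toL2 u)).norm (integrable_const ‖u‖)] at h2
    simp only [integral_const, probReal_univ, one_smul] at h2
    linarith [integral_norm_le (toL2 u), norm_toL2_le u]
  have := norm_integral_L2_le (D u) hx
  calc _ ≤ _ := norm_add_le _ _
    _ ≤ 3 * ‖u‖ := by linarith [norm_D_le u]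

/-- Evaluation of (the continuous representative of) elements of `W₂¹[0, 1]` at `x ∈ [0, 1]`. -/
def evalAt (x : Set.Icc (0 : ℝ) 1) : W21 →L[ℂ] ℂ :=
  LinearMap.mkContinuous
    { toFun := fun u => rep u x
      map_add' := fun u v => rep_add u v x.2
      map_smul' := fun a u => rep_smul a u x.2 } 3 (fun u => norm_rep_le u x.2)

/-- Bounded functions act on `L₂[0, 1]` by multiplication. -/
def mulBdd (h : ℝ → ℂ) (C : ℝ) (hm : AEStronglyMeasurable h μI) (hb : ∀ᵐ x ∂μI, ‖h x‖ ≤ C)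
    (g : L2I) : L2I :=
  MemLp.toLp (fun x => h x * g x) ((Lp.memLp g).mul' (memLp_top_of_bound hm C hb))

theorem memLp_primitive (g : L2I) : MemLp (fun x => ∫ t in (0 : ℝ)..x, g t) 2 μI :=
  MemLp.of_bound ((continuousOn_primitive_L2 g).aestronglyMeasurable measurableSet_Icc) ‖g‖
    (by filter_upwards [ae_mem_Icc] with x hx using norm_integral_L2_le g hx)

/-- The Volterra operator `g ↦ ∫₀ˣ g` on `L₂[0, 1]`. -/
def volterra : L2I →L[ℂ] L2I :=
  LinearMap.mkContinuous
    { toFun := fun g => (memLp_primitive g).toLp _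
      map_add' := fun f g => by
        ext1
        filter_upwards [(memLp_primitive (f + g)).coeFn_toLp, (memLp_primitive f).coeFn_toLp,
          (memLp_primitive g).coeFn_toLp, Lp.coeFn_add ((memLp_primitive f).toLp _)
          ((memLp_primitive g).toLp _), ae_mem_Icc] with x h1 h2 h3 h4 hx
        rw [h1, h4, Pi.add_apply, h2, h3, integral_add_L2 _ _ hx]
      map_smul' := fun a f => by
        ext1
        filter_upwards [(memLp_primitive (a • f)).coeFn_toLp, (memLp_primitive f).coeFn_toLp,
          Lp.coeFn_smul a ((memLp_primitive f).toLp _), ae_mem_Icc] with x h1 h2 h4 hx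
        rw [h1, RingHom.id_apply, h4, Pi.smul_apply, h2, integral_smul_L2 _ _ hx, smul_eq_mul] }
    1 (fun g => by
      have := Lp.norm_le_of_ae_bound (f := (memLp_primitive g).toLp _) (norm_nonneg g) (by
        filter_upwards [(memLp_primitive g).coeFn_toLp, ae_mem_Icc] with x h1 hx
        rw [h1]; exact norm_integral_L2_le g hx)
      have h1 : measureUnivNNReal μI = 1 := by
        rw [measureUnivNNReal, measure_univ]; rfl
      rw [h1] at this
      simp only [NNReal.coe_one, Real.one_rpow, one_mul] at this
      rw [one_mul]; exact this)

theorem volterra_ae (g : L2I) : ∀ᵐ x ∂μI, volterra g x = ∫ t in (0 : ℝ)..x, g t :=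
  (memLp_primitive g).coeFn_toLp

theorem isClosed_sobolevPairs : IsClosed (sobolevPairs : Set (WithLp 2 (L2I × L2I))) := by
  let Φ : WithLp 2 (L2I × L2I) →L[ℂ] L2I :=
    WithLp.fstL 2 ℂ L2I L2I - volterra ∘L WithLp.sndL 2 ℂ L2I L2I
  let one : L2I := Lp.const 2 μI (1 : ℂ)
  have h : (sobolevPairs : Set (WithLp 2 (L2I × L2I))) = Φ ⁻¹' (ℂ ∙ one : Submodule ℂ L2I) := by
    ext u
    have hone := Lp.coeFn_const 2 μI (1 : ℂ)
    have hsub := Lp.coeFn_sub u.fst (volterra u.snd)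
    have hv := volterra_ae u.snd
    rw [Set.mem_preimage, SetLike.mem_coe, SetLike.mem_coe, Submodule.mem_span_singleton]
    refine exists_congr fun c => ?_
    have hΦ : Φ u = u.fst - volterra u.snd := rfl
    have hsm := Lp.coeFn_smul c one
    rw [hΦ]
    constructor
    · intro hc
      ext1
      filter_upwards [hc, hone, hsub, hv, hsm] with x h1 h2 h3 h4 h5
      rw [h5, h3, Pi.smul_apply, Pi.sub_apply, h1, h4, h2]; simp
    · intro hc
      rw [← hc] at hsub
      filter_upwards [hone, hsub, hv, hsm] with x h2 h3 h4 h5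
      rw [h5, Pi.smul_apply, Pi.sub_apply, h4, h2] at h3
      simp only [Function.const_apply, smul_eq_mul, mul_one] at h3
      rw [h3]; ring
  rw [h]
  exact (Submodule.closed_of_finiteDimensional _).preimage Φ.continuous

instance : CompleteSpace W21 := isClosed_sobolevPairs.completeSpace_coe

theorem ac_primitive (g : L2I) (c : ℂ) :
    AbsolutelyContinuousOnInterval (fun x => c + ∫ t in (0 : ℝ)..x, g t) 0 1 := by
  have hG := IntervalIntegrable.absolutelyContinuousOnInterval_intervalIntegral (c := 0)
    (intervalIntegrable_L2 g).norm (by simp)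
  unfold AbsolutelyContinuousOnInterval at hG ⊢
  refine squeeze_zero' (Filter.Eventually.of_forall fun _ => Finset.sum_nonneg fun _ _ =>
    dist_nonneg) ?_ hG
  rw [Filter.eventually_inf_principal]
  filter_upwards with ⟨n, J⟩ hJ
  refine Finset.sum_le_sum fun i hi => ?_
  have h1 := (hJ.1 i hi).1
  have h2 := (hJ.1 i hi).2
  rw [Set.uIcc_of_le zero_le_one] at h1 h2
  have e1 := intervalIntegrable_L2' g h1
  have e2 := intervalIntegrable_L2' g h2
  rw [dist_eq_norm, dist_eq_norm, add_sub_add_left_eq_sub,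
    intervalIntegral.integral_interval_sub_left e1 e2,
    intervalIntegral.integral_interval_sub_left e1.norm e2.norm, Real.norm_eq_abs]
  exact intervalIntegral.norm_integral_le_abs_integral_norm

theorem ac_rep (u : W21) : AbsolutelyContinuousOnInterval (rep u) 0 1 :=
  ac_primitive (D u) _

theorem hasDerivAt_rep (u : W21) :
    ∀ᵐ x, x ∈ Set.Icc (0 : ℝ) 1 → HasDerivAt (rep u) (D u x) x := by
  have := (intervalIntegrable_L2 (D u)).ae_hasDerivAt_integral
  filter_upwards [this] with x hx h
  exact (hx (by rwa [Set.uIcc_of_le zero_le_one]) 0 (by simp)).const_add _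

theorem toL2_injective : Function.Injective toL2 := by
  rw [injective_iff_map_eq_zero]
  intro u hu
  have h0 : rep u =ᵐ[μI] fun _ => 0 := by
    have := toL2_ae u
    rw [hu] at this
    filter_upwards [this, Lp.coeFn_zero ℂ 2 μI] with x h1 h2
    rw [← h1, h2]; rfl
  have h1 := Measure.eqOn_Icc_of_ae_eq volume zero_ne_one h0 (continuousOn_rep u)
    continuousOn_const
  have hD : D u = 0 := by
    ext1
    have h2 := (ae_restrict_iff' (measurableSet_Icc (a := (0 : ℝ)) (b := 1))).2 (hasDerivAt_rep u)
    have h3 : ∀ᵐ x ∂μI, x ∈ Set.Ioo (0 : ℝ) 1 := by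
      rw [μI, ← restrict_Ioo_eq_restrict_Icc]
      exact ae_restrict_mem measurableSet_Ioo
    filter_upwards [h2, h3, Lp.coeFn_zero ℂ 2 μI] with x hx hx' hz
    rw [hz]
    refine hx.unique ((hasDerivAt_const x (0 : ℂ)).congr_of_eventuallyEq ?_)
    filter_upwards [Ioo_mem_nhds hx'.1 hx'.2] with t ht using h1 (Set.Ioo_subset_Icc_self ht)
  have := norm_sq_W21 u
  rw [hu, hD] at this
  simpa using this

theorem aesm_rep (u : W21) : AEStronglyMeasurable (rep u) μI :=
  (continuousOn_rep u).aestronglyMeasurable measurableSet_Icc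

theorem ae_norm_rep_le (u : W21) : ∀ᵐ x ∂μI, ‖rep u x‖ ≤ 3 * ‖u‖ := by
  filter_upwards [ae_mem_Icc] with x hx using norm_rep_le u hx

theorem mulBdd_ae (h : ℝ → ℂ) (C : ℝ) (hm : AEStronglyMeasurable h μI)
    (hb : ∀ᵐ x ∂μI, ‖h x‖ ≤ C) (g : L2I) :
    ∀ᵐ x ∂μI, mulBdd h C hm hb g x = h x * g x :=
  MemLp.coeFn_toLp _

theorem norm_mulBdd_le (h : ℝ → ℂ) (C : ℝ) (hm : AEStronglyMeasurable h μI)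
    (hb : ∀ᵐ x ∂μI, ‖h x‖ ≤ C) (g : L2I) : ‖mulBdd h C hm hb g‖ ≤ C * ‖g‖ := by
  refine Lp.norm_le_mul_norm_of_ae_le_mul ?_
  filter_upwards [mulBdd_ae h C hm hb g, hb] with x h1 h2
  rw [h1, norm_mul]
  gcongr

theorem integral_eq_of_ac {F : ℝ → ℂ} {f : L2I} (hF : AbsolutelyContinuousOnInterval F 0 1)
    (hf : ∀ᵐ x, x ∈ Set.Icc (0 : ℝ) 1 → HasDerivAt F (f x) x) {x : ℝ}
    (hx : x ∈ Set.Icc (0 : ℝ) 1) : F x = F 0 + ∫ t in (0 : ℝ)..x, f t := by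
  have h1 := hF.fun_sub (ac_primitive f 0)
  obtain ⟨C, hC⟩ := h1.const_of_ae_hasDerivAt_zero (by
    filter_upwards [hf, (intervalIntegrable_L2 f).ae_hasDerivAt_integral] with t h2 h3 ht
    have h4 := (h3 ht 0 (by simp)).const_add 0
    rw [Set.uIcc_of_le zero_le_one] at ht
    simpa using (h2 ht).fun_sub h4)
  rw [Set.uIcc_of_le zero_le_one] at hC
  have e1 := hC x hx
  have e0 := hC 0 (by simp)
  simp only [intervalIntegral.integral_same, zero_add, sub_zero] at e0 e1
  rw [e0, ← e1]; ring

theorem aesm_conj_rep (z : W21) : AEStronglyMeasurable (fun x => conj (rep z x)) μI :=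
  Complex.continuous_conj.comp_aestronglyMeasurable (aesm_rep z)

theorem ae_norm_conj_rep_le (z : W21) : ∀ᵐ x ∂μI, ‖conj (rep z x)‖ ≤ 3 * ‖z‖ := by
  simpa using ae_norm_rep_le z

/-- The function `y z̄`, as an element of `L₂[0, 1]`. -/
def mulConjFst (z y : W21) : L2I :=
  mulBdd (fun x => conj (rep z x)) (3 * ‖z‖) (aesm_conj_rep z) (ae_norm_conj_rep_le z) (toL2 y)

/-- The function `y' z̄ + y z̄'`, as an element of `L₂[0, 1]`. -/
def mulConjSnd (z y : W21) : L2I :=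
  mulBdd (fun x => conj (rep z x)) (3 * ‖z‖) (aesm_conj_rep z) (ae_norm_conj_rep_le z) (D y) +
    mulBdd (rep y) (3 * ‖y‖) (aesm_rep y) (ae_norm_rep_le y) (star (D z))

theorem mulConjFst_ae (z y : W21) : ∀ᵐ x ∂μI, mulConjFst z y x = rep y x * conj (rep z x) := by
  filter_upwards [mulBdd_ae _ _ (aesm_conj_rep z) (ae_norm_conj_rep_le z) (toL2 y), toL2_ae y]
    with x h1 h2
  rw [mulConjFst, h1, h2, mul_comm]

theorem mulConjSnd_ae (z y : W21) :
    ∀ᵐ x ∂μI, mulConjSnd z y x = D y x * conj (rep z x) + rep y x * conj (D z x) := by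
  filter_upwards [mulBdd_ae _ _ (aesm_conj_rep z) (ae_norm_conj_rep_le z) (D y),
    mulBdd_ae _ _ (aesm_rep y) (ae_norm_rep_le y) (star (D z)), Lp.coeFn_star (D z),
    Lp.coeFn_add (mulBdd _ _ (aesm_conj_rep z) (ae_norm_conj_rep_le z) (D y))
      (mulBdd _ _ (aesm_rep y) (ae_norm_rep_le y) (star (D z)))] with x h1 h2 h3 h4
  rw [mulConjSnd, h4, Pi.add_apply, h1, h2, h3, Pi.star_apply, mul_comm (conj (rep z x))]; rfl

theorem mulConj_mem (z y : W21) : WithLp.toLp 2 (mulConjFst z y, mulConjSnd z y) ∈ sobolevPairs := by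
  refine ⟨rep y 0 * conj (rep z 0), ?_⟩
  have hconj : AbsolutelyContinuousOnInterval (fun x => conj (rep z x)) 0 1 := by
    have := ac_rep z
    unfold AbsolutelyContinuousOnInterval at this ⊢
    simpa only [Complex.dist_conj_conj] using this
  have hac : AbsolutelyContinuousOnInterval (fun x => rep y x * conj (rep z x)) 0 1 :=
    (ac_rep y).fun_smul hconj
  have hd : ∀ᵐ x, x ∈ Set.Icc (0 : ℝ) 1 →
      HasDerivAt (fun x => rep y x * conj (rep z x)) (mulConjSnd z y x) x := by
    have := (ae_restrict_iff' (measurableSet_Icc (a := (0 : ℝ)) (b := 1))).1 (mulConjSnd_ae z y)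
    filter_upwards [this, hasDerivAt_rep y, hasDerivAt_rep z] with x h1 h2 h3 hx
    rw [h1 hx]
    exact (h2 hx).mul (h3 hx).star
  filter_upwards [mulConjFst_ae z y, ae_mem_Icc] with x h1 hx
  exact h1.trans (integral_eq_of_ac hac hd hx)

/-- The product `y z̄ ∈ W₂¹[0, 1]` of `y` and the complex conjugate of `z`. -/
def mulConj (z y : W21) : W21 := ⟨_, mulConj_mem z y⟩

theorem rep_mulConj (z y : W21) {x : ℝ} (hx : x ∈ Set.Icc (0 : ℝ) 1) :
    rep (mulConj z y) x = rep y x * conj (rep z x) := by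
  have h : rep (mulConj z y) =ᵐ[μI] fun x => rep y x * conj (rep z x) := by
    filter_upwards [mulConjFst_ae z y, toL2_ae (mulConj z y)] with x h1 h2
    rw [← h1, ← h2]; rfl
  exact Measure.eqOn_Icc_of_ae_eq volume zero_ne_one h (continuousOn_rep _)
    ((continuousOn_rep y).mul (Complex.continuous_conj.comp_continuousOn (continuousOn_rep z))) hx

theorem ext_rep {u v : W21} (h : ∀ x ∈ Set.Icc (0 : ℝ) 1, rep u x = rep v x) : u = v := by
  apply toL2_injective
  ext1
  filter_upwards [toL2_ae u, toL2_ae v, ae_mem_Icc] with x h1 h2 hx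
  rw [h1, h2, h x hx]

theorem norm_mulConj_le (z y : W21) : ‖mulConj z y‖ ≤ 9 * ‖z‖ * ‖y‖ := by
  have h1 : ‖mulConjFst z y‖ ≤ 3 * ‖z‖ * ‖y‖ :=
    (norm_mulBdd_le _ _ _ _ _).trans (by gcongr; exact norm_toL2_le y)
  have h2 : ‖mulConjSnd z y‖ ≤ 6 * ‖z‖ * ‖y‖ := by
    refine (norm_add_le _ _).trans ?_
    have a1 := norm_mulBdd_le _ _ (aesm_conj_rep z) (ae_norm_conj_rep_le z) (D y)
    have a2 := norm_mulBdd_le _ _ (aesm_rep y) (ae_norm_rep_le y) (star (D z))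
    have a3 : ‖star (D z)‖ ≤ 1 * ‖D z‖ := by
      refine Lp.norm_le_mul_norm_of_ae_le_mul ?_
      filter_upwards [Lp.coeFn_star (D z)] with x hx
      rw [hx, Pi.star_apply, norm_star, one_mul]
    replace a2 : _ ≤ 3 * ‖y‖ * ‖D z‖ := a2.trans (by gcongr; simpa using a3)
    have b1 : 3 * ‖z‖ * ‖D y‖ ≤ 3 * ‖z‖ * ‖y‖ := by gcongr; exact norm_D_le y
    have b2 : 3 * ‖y‖ * ‖D z‖ ≤ 3 * ‖y‖ * ‖z‖ := by gcongr; exact norm_D_le z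
    linarith
  have h3 := norm_sq_W21 (mulConj z y)
  have h4 : 0 ≤ ‖z‖ * ‖y‖ := by positivity
  have e1 : ‖toL2 (mulConj z y)‖ ≤ 3 * (‖z‖ * ‖y‖) := by rw [← mul_assoc]; exact h1
  have e2 : ‖D (mulConj z y)‖ ≤ 6 * (‖z‖ * ‖y‖) := by rw [← mul_assoc]; exact h2
  have n1 := norm_nonneg (toL2 (mulConj z y))
  have n2 := norm_nonneg (D (mulConj z y))
  rw [mul_assoc]
  refine abs_le_of_sq_le_sq' ?_ (by positivity) |>.2
  nlinarith

/-- The product `y z̄` as a continuous map, conjugate linear in `z` and linear in `y`. -/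
def mulConjL : W21 →L⋆[ℂ] W21 →L[ℂ] W21 :=
  LinearMap.mkContinuous₂
    (LinearMap.mk₂'ₛₗ (starRingEnd ℂ) (RingHom.id ℂ) mulConj
      (fun z z' y => ext_rep fun x hx => by
        rw [rep_add _ _ hx, rep_mulConj _ _ hx, rep_mulConj _ _ hx, rep_mulConj _ _ hx,
          rep_add _ _ hx, map_add, mul_add])
      (fun a z y => ext_rep fun x hx => by
        rw [rep_smul _ _ hx, rep_mulConj _ _ hx, rep_mulConj _ _ hx, rep_smul _ _ hx, map_mul]
        ring)
      (fun z y y' => ext_rep fun x hx => by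
        rw [rep_add _ _ hx, rep_mulConj _ _ hx, rep_mulConj _ _ hx, rep_mulConj _ _ hx,
          rep_add _ _ hx, add_mul])
      (fun a z y => ext_rep fun x hx => by
        rw [RingHom.id_apply, rep_smul _ _ hx, rep_mulConj _ _ hx, rep_mulConj _ _ hx,
          rep_smul _ _ hx, mul_assoc]))
    9 norm_mulConj_le

/-- A functional `q` on `W₂¹[0, 1]`, that is an element of `W₂⁻¹[0, 1]` with
`q y = ∫₀¹ q·y dx`, is real if it takes real values on real-valued functions. -/
def IsRealFunctional (q : W21 →L[ℂ] ℂ) : Prop :=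
  ∀ y : W21, (∀ x ∈ Set.Icc (0 : ℝ) 1, (rep y x).im = 0) → (q y).im = 0

/-- The vector `y^∧ = (y(0), y(1))`. -/
def trace : W21 →L[ℂ] (Fin 2 → ℂ) :=
  ContinuousLinearMap.pi ![evalAt ⟨0, by simp⟩, evalAt ⟨1, by simp⟩]

theorem trace_zero (u : W21) : trace u 0 = rep u 0 := rfl

theorem trace_one (u : W21) : trace u 1 = rep u 1 := rfl

/-- The subspace of those `y ∈ W₂¹[0, 1]` for which `y^∧` lies in the image of `U - 1`. -/
def boundarySubspace (U : Matrix (Fin 2) (Fin 2) ℂ) : Submodule ℂ W21 :=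
  (LinearMap.range (U - 1).mulVecLin).comap (trace : W21 →ₗ[ℂ] (Fin 2 → ℂ))

/-- The Hilbert space `ℌ_U = {y ∈ W₂¹[0, 1] | y^∧ ∈ im (U - 1)}`. -/
def HU (U : Matrix (Fin 2) (Fin 2) ℂ) : Type := boundarySubspace U

variable (U : Matrix (Fin 2) (Fin 2) ℂ)

instance : NormedAddCommGroup (HU U) := inferInstanceAs (NormedAddCommGroup (boundarySubspace U))

instance : InnerProductSpace ℂ (HU U) := inferInstanceAs (InnerProductSpace ℂ (boundarySubspace U))

/-- The inclusion `ℌ_U ⊆ W₂¹[0, 1]`. -/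
def incl : HU U →L[ℂ] W21 := (boundarySubspace U).subtypeL

theorem incl_mem (y : HU U) : incl U y ∈ boundarySubspace U := y.2

theorem incl_injective : Function.Injective (incl U) := Subtype.val_injective

theorem norm_incl (y : HU U) : ‖incl U y‖ = ‖y‖ := rfl

instance : CompleteSpace (HU U) := by
  have h : IsClosed (boundarySubspace U : Set W21) :=
    (Submodule.closed_of_finiteDimensional (LinearMap.range (U - 1).mulVecLin)).preimage
      trace.continuous
  exact h.completeSpace_coe

/-- The embedding `I : ℌ_U → L₂[0, 1]`. -/
def embI : HU U →L[ℂ] L2I := toL2 ∘L incl U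

/-- The space `L₂[0, 1]` with the norm `‖y‖ = ‖I* y‖`. -/
def L2Neg (_U : Matrix (Fin 2) (Fin 2) ℂ) : Type := L2I

instance : AddCommGroup (L2Neg U) := inferInstanceAs (AddCommGroup L2I)

instance : Module ℂ (L2Neg U) := inferInstanceAs (Module ℂ L2I)

/-- The operator `I*` on the space `L₂[0, 1]` with the norm `‖y‖ = ‖I* y‖`. -/
def embIAdj : L2Neg U →ₗ[ℂ] HU U :=
  ((ContinuousLinearMap.adjoint (embI U) : L2I →L[ℂ] HU U) : L2I →ₗ[ℂ] HU U)

instance : SeminormedAddCommGroup (L2Neg U) :=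
  SeminormedAddCommGroup.induced (L2Neg U) (HU U) (embIAdj U)

instance : NormedSpace ℂ (L2Neg U) := NormedSpace.induced ℂ (L2Neg U) (HU U) (embIAdj U)

/-- The space `ℌ'_U`, the completion of `L₂[0, 1]` with respect to the norm `‖y‖ = ‖I* y‖`. -/
def HU' : Type := UniformSpace.Completion (L2Neg U)

instance : NormedAddCommGroup (HU' U) :=
  inferInstanceAs (NormedAddCommGroup (UniformSpace.Completion (L2Neg U)))

instance : NormedSpace ℂ (HU' U) :=
  inferInstanceAs (NormedSpace ℂ (UniformSpace.Completion (L2Neg U)))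

instance : CompleteSpace (HU' U) :=
  inferInstanceAs (CompleteSpace (UniformSpace.Completion (L2Neg U)))

/-- The embedding of `L₂[0, 1]`, with the norm `‖y‖ = ‖I* y‖`, in its completion `ℌ'_U`. -/
def toHU' : L2Neg U →ₗᵢ[ℂ] HU' U :=
  (UniformSpace.Completion.toComplₗᵢ : L2Neg U →ₗᵢ[ℂ] UniformSpace.Completion (L2Neg U))

theorem denseRange_toHU' : DenseRange (toHU' U) :=
  UniformSpace.Completion.denseRange_coe (α := L2Neg U)

theorem denseRange_embIAdj : DenseRange (embIAdj U) := by
  have h := (embI U).adjoint.orthogonal_range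
  rw [ContinuousLinearMap.adjoint_adjoint] at h
  have hk : (embI U).ker = ⊥ :=
    LinearMap.ker_eq_bot.2 (toL2_injective.comp (incl_injective U))
  rw [hk] at h
  have h2 := (Submodule.topologicalClosure_eq_top_iff (K := (embI U).adjoint.range)).2 h
  have h3 := Submodule.dense_iff_topologicalClosure_eq_top.2 h2
  exact h3

/-- The isometry `I⁺ : ℌ'_U → ℌ_U` extending `I*` by continuity. It is surjective because the
range of `I*` is dense. -/
def iPlus : HU' U ≃ₗᵢ[ℂ] HU U :=
  (LinearEquiv.refl ℂ (L2Neg U)).extendOfIsometry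
    (toHU' U).toLinearMap (embIAdj U) (denseRange_toHU' U) (denseRange_embIAdj U)
    (fun x => ((toHU' U).norm_map x).symm)

theorem iPlus_toHU' (y : L2Neg U) : iPlus U (toHU' U y) = embIAdj U y :=
  LinearMap.extendOfNorm_eq (denseRange_toHU' U)
    ⟨1, fun x => by rw [one_mul]; exact ((toHU' U).norm_map x).symm.le⟩ y

theorem ae_norm_ofReal_le (p : Lp ℝ ∞ μI) : ∀ᵐ x ∂μI, ‖((p x : ℝ) : ℂ)‖ ≤ ‖p‖ := by
  filter_upwards [ae_le_eLpNormEssSup (f := p) (μ := μI)] with x hx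
  rw [Complex.norm_real, Lp.norm_def, eLpNorm_exponent_top, ← toReal_enorm]
  refine ENNReal.toReal_mono ?_ hx
  rw [← eLpNorm_exponent_top]
  exact Lp.eLpNorm_ne_top p

theorem aesm_ofReal (p : Lp ℝ ∞ μI) : AEStronglyMeasurable (fun x => ((p x : ℝ) : ℂ)) μI :=
  Complex.continuous_ofReal.comp_aestronglyMeasurable (Lp.aestronglyMeasurable p)

/-- Multiplication by a real function `p` of class `L_∞[0, 1]`, as an operator on `L₂[0, 1]`. -/
def mulLinf (p : Lp ℝ ∞ μI) : L2I →L[ℂ] L2I :=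
  LinearMap.mkContinuous
    { toFun := mulBdd (fun x => ((p x : ℝ) : ℂ)) ‖p‖ (aesm_ofReal p) (ae_norm_ofReal_le p)
      map_add' := fun f g => by
        have hm := mulBdd_ae _ _ (aesm_ofReal p) (ae_norm_ofReal_le p)
        ext1
        filter_upwards [hm f, hm g, hm (f + g), Lp.coeFn_add f g, Lp.coeFn_add
          (mulBdd _ _ (aesm_ofReal p) (ae_norm_ofReal_le p) f)
          (mulBdd _ _ (aesm_ofReal p) (ae_norm_ofReal_le p) g)] with x h1 h2 h3 h4 h5
        rw [h3, h5, h4, Pi.add_apply, Pi.add_apply, h1, h2, mul_add]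
      map_smul' := fun a f => by
        have hm := mulBdd_ae _ _ (aesm_ofReal p) (ae_norm_ofReal_le p)
        ext1
        filter_upwards [hm f, hm (a • f), Lp.coeFn_smul a f, Lp.coeFn_smul a
          (mulBdd _ _ (aesm_ofReal p) (ae_norm_ofReal_le p) f)] with x h1 h3 h4 h5
        rw [h3, RingHom.id_apply, h5, h4, Pi.smul_apply, Pi.smul_apply, h1, smul_eq_mul,
          smul_eq_mul]
        ring }
    ‖p‖ (fun g => norm_mulBdd_le _ _ (aesm_ofReal p) (ae_norm_ofReal_le p) g)

theorem mulLinf_ae (p : Lp ℝ ∞ μI) (g : L2I) : ∀ᵐ x ∂μI, mulLinf p g x = p x * g x :=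
  mulBdd_ae _ _ (aesm_ofReal p) (ae_norm_ofReal_le p) g

/-- The numbers `V₁₁` and `V₂₂`; the values do not depend on the choice of the argument. -/
def V (k : Fin 2) : ℝ := if U k k = 1 then 0 else -Real.cot ((U k k).arg / 2)

/-- The sesquilinear form `(z, y) ↦ ∫₀¹ p y' z̄' dx + ∫₀¹ q y z̄ dx + ⟨V y^∧, z^∧⟩` on `ℌ_U`. -/
def mainForm (p : Lp ℝ ∞ μI) (q : W21 →L[ℂ] ℂ) : HU U →L⋆[ℂ] HU U →L[ℂ] ℂ :=
  ContinuousLinearMap.bilinearComp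
    (((innerSL ℂ).bilinearComp D (mulLinf p ∘L D) : W21 →L⋆[ℂ] W21 →L[ℂ] ℂ)
      + (q.postcomp W21) ∘SL mulConjL
      + ∑ k, (V U k : ℂ) • ((innerSL ℂ).bilinearComp (ContinuousLinearMap.proj k ∘L trace)
          (ContinuousLinearMap.proj k ∘L trace) : W21 →L⋆[ℂ] W21 →L[ℂ] ℂ))
    (incl U) (incl U)

/-- The sesquilinear form `(z, y) ↦ ∫₀¹ r y z̄ dx` on `ℌ_U`. -/
def weightForm (r : W21 →L[ℂ] ℂ) : HU U →L⋆[ℂ] HU U →L[ℂ] ℂ :=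
  ContinuousLinearMap.bilinearComp ((r.postcomp W21) ∘SL mulConjL)
    (incl U) (incl U)

/-- The bounded operator `A` on `ℌ_U` with `⟨A y, z⟩ = B(z, y)` for all `y` and `z`. The scalar
product `⟨·, ·⟩` is linear in its first argument here, so `⟨A y, z⟩` is `inner ℂ z (A y)`. -/
def opOf (B : HU U →L⋆[ℂ] HU U →L[ℂ] ℂ) : HU U →L[ℂ] HU U :=
  (InnerProductSpace.continuousLinearMapOfBilin B).adjoint

variable {U} in
theorem inner_opOf (B : HU U →L⋆[ℂ] HU U →L[ℂ] ℂ) (z y : HU U) :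
    inner ℂ z (opOf U B y) = B z y := by
  rw [opOf, ContinuousLinearMap.adjoint_inner_right,
    InnerProductSpace.continuousLinearMapOfBilin_apply]

/-- The pencil `T(λ) : ℌ_U → ℌ'_U`, given by
`⟨I⁺T(λ) y, y⟩ = ∫₀¹ p |y'|² dx + ∫₀¹ (q - λ r) |y|² dx + ⟨V y^∧, y^∧⟩`. -/
def pencil (p : Lp ℝ ∞ μI) (q r : W21 →L[ℂ] ℂ) (lam : ℂ) : HU U →L[ℂ] HU' U :=
  ((iPlus U).symm : HU U →L[ℂ] HU' U) ∘L
    (opOf U (mainForm U p q) - lam • opOf U (weightForm U r))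

/-- The operator `I⁺T(λ) : ℌ_U → ℌ_U`. -/
def iPlusPencil (p : Lp ℝ ∞ μI) (q r : W21 →L[ℂ] ℂ) (lam : ℂ) : HU U →L[ℂ] HU U :=
  ((iPlus U) : HU' U →L[ℂ] HU U) ∘L pencil U p q r lam

/-- The identity that determines `I⁺T(λ)` by polarization, and hence `T(λ)`. -/
theorem inner_iPlusPencil (p : Lp ℝ ∞ μI) (q r : W21 →L[ℂ] ℂ) (lam : ℂ) (y : HU U) :
    inner ℂ y (iPlusPencil U p q r lam y) =
      (∫ x in (0 : ℝ)..1, ((p x * ‖D (incl U y) x‖ ^ 2 : ℝ) : ℂ)) + (q - lam • r) (mulConj (incl U y) (incl U y))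
        + ∑ k, ((V U k * ‖trace (incl U y) k‖ ^ 2 : ℝ) : ℂ) := by
  have h1 : iPlusPencil U p q r lam y
      = opOf U (mainForm U p q) y - lam • opOf U (weightForm U r) y := by
    simp [iPlusPencil, pencil]
  have h2 : inner ℂ (D (incl U y)) (mulLinf p (D (incl U y)))
      = ∫ x in (0 : ℝ)..1, ((p x * ‖D (incl U y) x‖ ^ 2 : ℝ) : ℂ) := by
    rw [intervalIntegral.integral_of_le zero_le_one, ← integral_Icc_eq_integral_Ioc,
      L2.inner_def]
    refine integral_congr_ae ?_
    filter_upwards [mulLinf_ae p (D (incl U y))] with x hx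
    rw [hx, RCLike.inner_apply, mul_assoc, Complex.mul_conj, Complex.normSq_eq_norm_sq]
    push_cast; rfl
  have h3 : ∀ k, inner ℂ (trace (incl U y) k) (trace (incl U y) k) = ((‖trace (incl U y) k‖ ^ 2 : ℝ) : ℂ) := fun k => by
    rw [inner_self_eq_norm_sq_to_K]; norm_cast
  have h4 : mainForm U p q y y = inner ℂ (D (incl U y)) (mulLinf p (D (incl U y))) + q (mulConj (incl U y) (incl U y))
      + ∑ k, (V U k : ℂ) * inner ℂ (trace (incl U y) k) (trace (incl U y) k) := by
    simp only [mainForm, ContinuousLinearMap.bilinearComp_apply, add_apply,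
      sum_apply, smul_apply]
    rfl
  have h5 : weightForm U r y y = r (mulConj (incl U y) (incl U y)) := rfl
  rw [h1, inner_sub_right, inner_smul_right, inner_opOf, inner_opOf, h4, h2, h5]
  simp only [h3, sub_apply, smul_apply, smul_eq_mul]
  push_cast
  ring

theorem hasDerivAt_pencil (p : Lp ℝ ∞ μI) (q r : W21 →L[ℂ] ℂ) (lam : ℂ) :
    HasDerivAt (pencil U p q r)
      (-(((iPlus U).symm : HU U →L[ℂ] HU' U) ∘L opOf U (weightForm U r))) lam := by
  have h : pencil U p q r = fun z : ℂ =>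
      ((iPlus U).symm : HU U →L[ℂ] HU' U) ∘L opOf U (mainForm U p q)
        - z • (((iPlus U).symm : HU U →L[ℂ] HU' U) ∘L opOf U (weightForm U r)) := by
    funext z; ext y; simp [pencil]
  rw [h]
  simpa using ((hasDerivAt_id lam).smul_const
    (((iPlus U).symm : HU U →L[ℂ] HU' U) ∘L opOf U (weightForm U r))).const_sub
    (((iPlus U).symm : HU U →L[ℂ] HU' U) ∘L opOf U (mainForm U p q))

end SturmLiouville

namespace OperatorPencil

variable {E F : Type*} [NormedAddCommGroup E] [NormedSpace ℂ E]
  [NormedAddCommGroup F] [NormedSpace ℂ F]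

/-- The spectrum of an operator function `T`: the points `λ` at which `T(λ)` has no bounded
inverse. -/
def spectrum (T : ℂ → E →L[ℂ] F) : Set ℂ := {lam | ¬ (T lam).IsInvertible}

/-- `λ` is a simple eigenvalue of `T`: the kernel of `T(λ)` is one-dimensional, and no
eigenvector `y` has an associated vector, that is a vector `z` with `T(λ) z + T'(λ) y = 0`. -/
def IsSimpleEigenvalue (T : ℂ → E →L[ℂ] F) (lam : ℂ) : Prop :=
  Module.finrank ℂ (T lam).ker = 1 ∧
    ∀ y, T lam y = 0 → y ≠ 0 → ∀ z, T lam z + deriv T lam y ≠ 0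

/-- The index of inertia of a quadratic form `m`: the supremum of the dimensions of the subspaces
on which `m` is uniformly negative. -/
def formIndex (m : E → ℝ) : ℕ∞ :=
  ⨆ (M : Submodule ℂ E) (_ : ∃ c > 0, ∀ y ∈ M, m y ≤ -c * ‖y‖ ^ 2),
    Cardinal.toENat (Module.rank ℂ M)

variable {H : Type*} [NormedAddCommGroup H] [InnerProductSpace ℂ H]

/-- The index of inertia of a Hermitian operator `A`: that of the form `⟨A y, y⟩`. -/
def inertia (A : H →L[ℂ] H) : ℕ∞ := formIndex A.reApplyInnerSelf

/-- Positivity of a Hermitian operator `A`: `⟨A y, y⟩ > 0` for all `y ≠ 0`. -/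
def IsPositiveOperator (A : H →L[ℂ] H) : Prop := ∀ y : H, y ≠ 0 → 0 < A.reApplyInnerSelf y

end OperatorPencil

end

/-! Put `A = I⁺T(ξ)` and let `R` be the operator of the form `∫ r y z̄`. Then `I⁺T(λ) = A - (λ - ξ)
R`, with `A` positive, and `A`, `R` bounded and self-adjoint. Everything follows from three facts
about this linear pencil.

Compactness. A functional in `W₂⁻¹` is a norm limit of functionals given by functions in `L₂`. Hence
its form `s(y z̄)` is bounded by `(ε‖y‖ + C‖y‖_{L₂})‖z‖` for every `ε > 0`. As the embedding in `L₂`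
is compact, `R` is compact, and `A` is a compact perturbation of the coercive operator of `∫ p y'
z̄' + ∫ y z̄`. Positivity excludes a kernel of `A`, so `A` is invertible by the Fredholm alternative
(`isUnit_iPlusPencil_of_isPositiveOperator`).

Symmetrization. With `S = √A` and `K = S⁻¹ R S⁻¹` one has `A - t R = S (1 - t K) S`, where `K` is
compact and self-adjoint. Thus the spectrum is real and discrete. The index of `1 - t K` is the
number of eigenvalues of `t K` above `1`, counted with multiplicity; these are the numbers `1/s`
with `0 < s < 1` and `A - s t R` degenerate (`finite_and_inertia_sub`). If all kernels have
dimension at most one, the index at `λ` is therefore the number of spectral points strictly between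
`ξ` and `λ`, which at `λ_n` is `|n| - 1`.

Simplicity. If `T(λ) y = 0` and `y ≠ 0`, then `(λ - ξ)⟨Ry, y⟩ = ⟨Ay, y⟩ > 0`, so `⟨Ry, y⟩ ≠ 0`; an
associated vector would force `⟨Ry, y⟩ = 0`. That kernels are at most one-dimensional rests on
uniqueness for the weak Cauchy problem at `0` (`eq_zero_of_rep_zero_eq_zero`), obtained with
distributional coefficients from an exponentially weighted estimate. The boundary conditions are
separated, so they fix one of the two Cauchy data at `0`. -/

namespace OperatorPencil

open Module End

/-! ### The index of inertia of a quadratic form. -/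

section FormIndex

variable {E : Type*} [NormedAddCommGroup E] [NormedSpace ℂ E]

/-- A uniformly negative subspace meets `L` only in zero, so it embeds in the quotient by `L`, which
is isomorphic to `W`. The form need only be nonnegative on `L`, so null vectors there do no harm. -/
theorem formIndex_eq_of_isCompl {m : E → ℝ} {W L : Submodule ℂ E} (h : IsCompl W L)
    (hW : ∃ c > 0, ∀ y ∈ W, m y ≤ -c * ‖y‖ ^ 2) (hL : ∀ y ∈ L, 0 ≤ m y) :
    formIndex m = Cardinal.toENat (Module.rank ℂ W) := by
  refine le_antisymm (iSup₂_le fun M hM => ?_) (le_iSup₂_of_le W hW le_rfl)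
  obtain ⟨c, hc, hM⟩ := hM
  refine OrderHomClass.mono Cardinal.toENat ?_
  rw [← (L.quotientEquivOfIsCompl W h.symm).rank_eq]
  refine (L.mkQ.comp M.subtype).rank_le_of_injective ?_
  rw [injective_iff_map_eq_zero]
  intro y hy
  have hyL : (y : E) ∈ L := by simpa using hy
  have h1 := hM y y.2
  have h2 := hL y hyL
  have h3 : ‖(y : E)‖ ^ 2 ≤ 0 := by nlinarith [sq_nonneg ‖(y : E)‖]
  have h4 : ‖(y : E)‖ = 0 := by nlinarith [norm_nonneg (y : E)]
  exact Subtype.ext (norm_eq_zero.1 h4)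

theorem formIndex_le_formIndex_comp (m : E → ℝ) (S : E ≃L[ℂ] E) :
    formIndex m ≤ formIndex (m ∘ S) := by
  refine iSup₂_le fun M ⟨c, hc, hM⟩ => ?_
  have hr := LinearEquiv.rank_map_eq S.symm.toLinearEquiv M
  rw [← hr]
  refine le_iSup₂_of_le (M.map (S.symm.toLinearEquiv : E →ₗ[ℂ] E))
    -- The summand `1` keeps the denominator positive even when the space is trivial.
    ⟨c / (‖(S.symm : E →L[ℂ] E)‖ + 1) ^ 2, by positivity, ?_⟩ le_rfl
  rintro _ ⟨x, hx, rfl⟩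
  have h1 := hM x hx
  have h2 : ‖S.symm x‖ ≤ (‖(S.symm : E →L[ℂ] E)‖ + 1) * ‖x‖ :=
    ((S.symm : E →L[ℂ] E).le_opNorm x).trans (by gcongr; linarith)
  have h3 : ‖S.symm x‖ ^ 2 ≤ (‖(S.symm : E →L[ℂ] E)‖ + 1) ^ 2 * ‖x‖ ^ 2 := by
    rw [← mul_pow]; gcongr
  have h4 : (m ∘ S) (S.symm x) = m x := by simp
  change (m ∘ S) (S.symm x) ≤ _ * ‖S.symm x‖ ^ 2
  rw [h4, neg_mul, div_mul_eq_mul_div]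
  have h5 : c * ‖S.symm x‖ ^ 2 / (‖(S.symm : E →L[ℂ] E)‖ + 1) ^ 2 ≤ c * ‖x‖ ^ 2 := by
    rw [div_le_iff₀ (by positivity)]
    nlinarith
  linarith

theorem formIndex_comp (m : E → ℝ) (S : E ≃L[ℂ] E) : formIndex (m ∘ S) = formIndex m := by
  refine le_antisymm ?_ (formIndex_le_formIndex_comp m S)
  have := formIndex_le_formIndex_comp (m ∘ S) S.symm
  rwa [show (m ∘ S) ∘ S.symm = m by ext; simp] at this

end FormIndex

/-! ### Compact self-adjoint operators and the index of `1 - K`. -/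

variable {H : Type*} [NormedAddCommGroup H] [InnerProductSpace ℂ H]

theorem exists_unit_eigenvector {K : H →L[ℂ] H} {μ : ℝ}
    (h : HasEigenvalue (K : End ℂ H) (μ : ℂ)) : ∃ x : H, ‖x‖ = 1 ∧ K x = (μ : ℂ) • x := by
  obtain ⟨x, hx⟩ := h.exists_hasEigenvector
  have h0 : ‖x‖ ≠ 0 := norm_ne_zero_iff.2 hx.2
  refine ⟨((‖x‖⁻¹ : ℝ) : ℂ) • x, ?_, ?_⟩
  · rw [norm_smul, Complex.norm_real, norm_inv, norm_norm, inv_mul_cancel₀ h0]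
  · have := hx.apply_eq_smul
    simp only [ContinuousLinearMap.coe_coe] at this
    rw [map_smul, this, smul_comm]

variable [CompleteSpace H]

/-- Spectral points above `t > 0` are nonzero, hence eigenvalues by compactness. So the spectrum
lies below `t`, and the functional calculus gives `K ≤ t`. -/
theorem reApplyInnerSelf_le_of_forall_hasEigenvalue {K : H →L[ℂ] H} (hK : IsCompactOperator K)
    (hs : IsSelfAdjoint K) {t : ℝ} (ht : 0 < t)
    (h : ∀ μ : ℝ, HasEigenvalue (K : End ℂ H) (μ : ℂ) → μ ≤ t) (x : H) :
    K.reApplyInnerSelf x ≤ t * ‖x‖ ^ 2 := by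
  have h1 : K ≤ algebraMap ℝ (H →L[ℂ] H) t := by
    refine le_algebraMap_of_spectrum_le fun μ hμ => ?_
    by_contra! hlt
    refine absurd (h μ ?_) hlt.not_ge
    rw [hK.hasEigenvalue_iff_mem_spectrum (by exact_mod_cast (ht.trans hlt).ne')]
    exact (spectrum.algebraMap_mem_iff ℂ).2 hμ
  have h2 := ((ContinuousLinearMap.le_def _ _).1 h1).re_inner_nonneg_left x
  simp only [sub_apply, inner_sub_left, map_sub] at h2
  rw [ContinuousLinearMap.reApplyInnerSelf_apply]
  have h3 : (algebraMap ℝ (H →L[ℂ] H) t) x = (t : ℂ) • x := by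
    simp [Algebra.algebraMap_eq_smul_one]
  rw [h3, inner_smul_left, inner_self_eq_norm_sq_to_K] at h2
  have h4 : RCLike.re (conj (t : ℂ) * ((‖x‖ : ℂ)) ^ 2) = t * ‖x‖ ^ 2 := by
    rw [Complex.conj_ofReal]; norm_cast
  have h5 : ((‖x‖ : ℝ) : ℂ) = (RCLike.ofReal ‖x‖ : ℂ) := rfl
  rw [h5] at h4
  linarith

theorem inner_eq_zero_of_eigenvalue_ne {K : H →L[ℂ] H} (hs : IsSelfAdjoint K) {μ ν : ℝ}
    (h : μ ≠ ν) {x y : H} (hx : K x = (μ : ℂ) • x) (hy : K y = (ν : ℂ) • y) :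
    inner ℂ x y = 0 := by
  have h1 := hs.isSymmetric x y
  simp only [ContinuousLinearMap.coe_coe] at h1
  rw [hx, hy, inner_smul_left, inner_smul_right, Complex.conj_ofReal] at h1
  have h2 : ((μ : ℂ) - ν) * inner ℂ x y = 0 := by rw [sub_mul, h1, sub_self]
  refine (mul_eq_zero.1 h2).resolve_left ?_
  exact sub_ne_zero.2 (by exact_mod_cast h)

/-- Unit eigenvectors for distinct eigenvalues are orthogonal. Their images have norm above `1`, so
these are more than `1` apart and have no convergent subsequence. -/
theorem finite_setOf_hasEigenvalue_gt_one {K : H →L[ℂ] H} (hK : IsCompactOperator K)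
    (hs : IsSelfAdjoint K) : {μ : ℝ | 1 < μ ∧ HasEigenvalue (K : End ℂ H) (μ : ℂ)}.Finite := by
  by_contra hinf
  let f := Set.Infinite.natEmbedding _ hinf
  choose e he1 he2 using fun n => exists_unit_eigenvector (f n).2.2
  obtain ⟨C, hC, hC'⟩ := hK.image_closedBall_subset_compact 1
  obtain ⟨y, -, ψ, hψ, hψy⟩ := hC.tendsto_subseq
    (fun n ↦ hC' ⟨e n, by simp [he1], rfl⟩)
  have := hψy.cauchySeq
  rw [Metric.cauchySeq_iff'] at this
  obtain ⟨N, hN⟩ := this 1 one_pos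
  have h1 := hN (N + 1) (by simp)
  set a := ψ (N + 1)
  set b := ψ N
  have hab : a ≠ b := fun h => by simpa using hψ.injective h
  have hne : ((f a : ℝ)) ≠ f b := fun h => hab (f.injective (Subtype.ext h))
  have h0 := inner_eq_zero_of_eigenvalue_ne hs hne (he2 a) (he2 b)
  have h2 : ‖K (e a) - K (e b)‖ * ‖K (e a) - K (e b)‖
      = ‖K (e a)‖ * ‖K (e a)‖ + ‖K (e b)‖ * ‖K (e b)‖ := by
    have h3 := norm_add_sq_eq_norm_sq_add_norm_sq_of_inner_eq_zero (𝕜 := ℂ) (K (e a)) (-K (e b))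
      (by rw [inner_neg_right, he2, he2, inner_smul_left, inner_smul_right, h0]; simp)
    rwa [norm_neg, ← sub_eq_add_neg] at h3
  have h3 : ∀ n, 1 < ‖K (e n)‖ := fun n => by
    rw [he2, norm_smul, he1, mul_one, Complex.norm_real]
    exact (f n).2.1.trans_le (le_abs_self _)
  have h4 : ‖K (e a) - K (e b)‖ < 1 := by simpa [dist_eq_norm] using h1
  nlinarith [h3 a, h3 b, norm_nonneg (K (e a) - K (e b))]

/-- The span `W` of one eigenvector for each eigenvalue above `1` and its orthogonal complement
split the form: negative on `W`, nonnegative on `Wᗮ`. The eigenvalue `1` contributes only null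
vectors and is not counted. -/
theorem inertia_one_sub {K : H →L[ℂ] H} (hK : IsCompactOperator K) (hs : IsSelfAdjoint K)
    (h1 : ∀ μ : ℝ, 1 < μ → finrank ℂ (eigenspace (K : End ℂ H) (μ : ℂ)) ≤ 1) :
    inertia (1 - K)
      = ({μ : ℝ | 1 < μ ∧ HasEigenvalue (K : End ℂ H) (μ : ℂ)}.ncard : ℕ∞) := by
  have hfin := finite_setOf_hasEigenvalue_gt_one hK hs
  set G := {μ : ℝ | 1 < μ ∧ HasEigenvalue (K : End ℂ H) (μ : ℂ)}
  have := hfin.fintype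
  choose e he1 he2 using fun μ : G => exists_unit_eigenvector μ.2.2
  have hon : Orthonormal ℂ e := ⟨he1, fun μ ν h =>
    inner_eq_zero_of_eigenvalue_ne hs (fun h' => h (Subtype.ext h')) (he2 μ) (he2 ν)⟩
  let W := Submodule.span ℂ (Set.range e)
  have : FiniteDimensional ℂ W := FiniteDimensional.span_of_finite ℂ (Set.finite_range e)
  have hinv : W ∈ invtSubmodule (K : End ℂ H) := by
    change W ≤ W.comap _
    refine Submodule.span_le.2 ?_
    rintro _ ⟨μ, rfl⟩
    change K (e μ) ∈ W
    rw [he2]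
    exact W.smul_mem _ (Submodule.subset_span ⟨μ, rfl⟩)
  have hinv' : ∀ x ∈ Wᗮ, K x ∈ Wᗮ :=
    (mem_invtSubmodule_iff_forall_mem_of_mem _).1
      (hs.isSymmetric.orthogonalComplement_mem_invtSubmodule hinv)
  rw [inertia, formIndex_eq_of_isCompl (Submodule.isCompl_orthogonal (K := W))]
  · rw [← finrank_eq_rank, finrank_span_eq_card hon.linearIndependent, Set.ncard_eq_toFinset_card',
      Set.toFinset_card, map_natCast]
  -- The gap between `1` and the least of the finitely many eigenvalues gives uniform negativity;
  -- any constant serves if there are none.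
  · obtain ⟨c, hc, hcG⟩ : ∃ c > 0, ∀ μ : G, 1 + c ≤ (μ : ℝ) := by
      rcases isEmpty_or_nonempty G with hE | hE
      · exact ⟨1, one_pos, fun μ => isEmptyElim μ⟩
      · obtain ⟨μ₀, hμ₀⟩ := Finite.exists_min (fun μ : G => (μ : ℝ))
        exact ⟨μ₀ - 1, sub_pos.2 μ₀.2.1, fun μ => by linarith [hμ₀ μ]⟩
    refine ⟨c, hc, fun y hy => ?_⟩
    obtain ⟨l, rfl⟩ := (Submodule.mem_span_range_iff_exists_fun ℂ).1 hy
    have hKy : (1 - K) (∑ i, l i • e i) = ∑ i, (l i * (1 - (i : ℝ) : ℂ)) • e i := by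
      simp only [map_sum, map_smul]
      refine Finset.sum_congr rfl fun i _ => ?_
      rw [sub_apply, he2, mul_smul, sub_smul]
      simp
    have hn : ‖∑ i, l i • e i‖ ^ 2 = ∑ i, ‖l i‖ ^ 2 := by
      rw [← inner_self_eq_norm_sq (𝕜 := ℂ), hon.inner_sum, map_sum]
      refine Finset.sum_congr rfl fun i _ => ?_
      rw [Complex.conj_mul']; norm_cast
    rw [ContinuousLinearMap.reApplyInnerSelf_apply, hKy, hon.inner_sum, hn, map_sum,
      Finset.mul_sum]
    refine Finset.sum_le_sum fun i _ => ?_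
    have : RCLike.re (conj (l i * (1 - (i : ℝ) : ℂ)) * l i) = ‖l i‖ ^ 2 * (1 - (i : ℝ)) := by
      have : conj (l i * (1 - (i : ℝ) : ℂ)) * l i = ((‖l i‖ ^ 2 * (1 - (i : ℝ)) : ℝ) : ℂ) := by
        push_cast
        rw [← Complex.conj_mul' (l i)]
        simp only [map_mul, map_sub, map_one, Complex.conj_ofReal]
        ring
      rw [this]; norm_cast
    rw [this]
    nlinarith [hcG i, sq_nonneg ‖l i‖]
  · intro y hy
    let K' : Wᗮ →L[ℂ] Wᗮ := K.restrict hinv'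
    have hK' : IsCompactOperator K' := hK.restrict' hinv'
    have hs' : IsSelfAdjoint K' := ContinuousLinearMap.isSelfAdjoint_iff_isSymmetric.2
      (hs.isSymmetric.restrict_invariant hinv')
    have := reApplyInnerSelf_le_of_forall_hasEigenvalue hK' hs' one_pos (fun μ hμ => ?_) ⟨y, hy⟩
    · rw [ContinuousLinearMap.reApplyInnerSelf_apply] at this ⊢
      have e1 : inner ℂ (K' ⟨y, hy⟩) ⟨y, hy⟩ = inner ℂ (K y) y := rfl
      have e2 : ‖(⟨y, hy⟩ : Wᗮ)‖ = ‖y‖ := rfl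
      rw [e1, e2] at this
      rw [sub_apply, inner_sub_left, map_sub, one_apply_eq_self, inner_self_eq_norm_sq (𝕜 := ℂ)]
      linarith
    -- An eigenvector of the restriction for `μ > 1` lies in an eigenspace of `K` that is a line
    -- through `e i`. It would then lie in both `W` and `Wᗮ`.
    · by_contra! hlt
      obtain ⟨x, hx1, hx2⟩ := exists_unit_eigenvector hμ
      have hKx : K x = (μ : ℂ) • (x : H) := congrArg Subtype.val hx2
      have hx0 : (x : H) ≠ 0 := fun h => by
        have : ‖(x : H)‖ = 1 := hx1
        rw [h, norm_zero] at this
        exact zero_ne_one this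
      have hev : HasEigenvalue (K : End ℂ H) (μ : ℂ) :=
        hasEigenvalue_of_hasEigenvector ⟨mem_eigenspace_iff.2 hKx, hx0⟩
      let i : G := ⟨μ, hlt, hev⟩
      have hfd : FiniteDimensional ℂ (eigenspace (K : End ℂ H) (μ : ℂ)) :=
        K.finite_dimensional_eigenspace hK _ (by exact_mod_cast (zero_lt_one.trans hlt).ne')
      have hi0 : e i ≠ 0 := fun h => by
        have := he1 i
        rw [h, norm_zero] at this
        exact zero_ne_one this
      obtain ⟨v, hv⟩ := finrank_le_one_iff.1 (h1 μ hlt)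
      obtain ⟨a, ha⟩ := hv ⟨x, mem_eigenspace_iff.2 hKx⟩
      obtain ⟨b, hb⟩ := hv ⟨e i, mem_eigenspace_iff.2 (he2 i)⟩
      have ha' : a • (v : H) = x := congrArg Subtype.val ha
      have hb' : b • (v : H) = e i := congrArg Subtype.val hb
      have hb0 : b ≠ 0 := fun h => hi0 (by rw [← hb', h, zero_smul])
      have hxW : (x : H) ∈ W := by
        have : (x : H) = (a * b⁻¹) • e i := by
          rw [← hb', smul_smul, mul_assoc, inv_mul_cancel₀ hb0, mul_one, ha']
        rw [this]
        exact W.smul_mem _ (Submodule.subset_span ⟨i, rfl⟩)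
      exact hx0 (inner_self_eq_zero.1 (Submodule.inner_right_of_mem_orthogonal hxW x.2))

/-! ### The pencil `A - t R` with `A` positive and `R` compact. -/

/-- Fredholm alternative: `A - C = A (1 - A⁻¹C)`, and `1` is either an eigenvalue of the compact
operator `A⁻¹C` or a regular point. -/
theorem isUnit_sub_of_ker_eq_bot {A C : H →L[ℂ] H} (hA : IsUnit A) (hC : IsCompactOperator C)
    (h : (A - C).ker = ⊥) : IsUnit (A - C) := by
  obtain ⟨a, rfl⟩ := hA
  have hT : IsCompactOperator ((↑a⁻¹ : H →L[ℂ] H) * C : H →L[ℂ] H) :=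
    hC.clm_comp (↑a⁻¹ : H →L[ℂ] H)
  have hfac : (a : H →L[ℂ] H) - C = a * (1 - ↑a⁻¹ * C) := by
    rw [mul_sub, mul_one, Units.mul_inv_cancel_left]
  rcases hT.hasEigenvalue_or_mem_resolventSet one_ne_zero with h1 | h1
  · obtain ⟨x, hx⟩ := h1.exists_hasEigenvector
    have h2 : (↑a⁻¹ : H →L[ℂ] H) (C x) = x := by simpa using hx.apply_eq_smul
    have h3 : x ∈ ((a : H →L[ℂ] H) - C).ker := by
      have h4 : ((a : H →L[ℂ] H) * (1 - ↑a⁻¹ * C)) x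
          = (a : H →L[ℂ] H) (x - (↑a⁻¹ : H →L[ℂ] H) (C x)) := rfl
      rw [LinearMap.mem_ker, hfac, ContinuousLinearMap.coe_coe, h4, h2, sub_self, map_zero]
    rw [h, Submodule.mem_bot] at h3
    exact absurd h3 hx.2
  · rw [spectrum.mem_resolventSet_iff, map_one] at h1
    rw [hfac]
    exact a.isUnit.mul h1

theorem inner_apply_self_eq_ofReal {A : H →L[ℂ] H} (hA : IsSelfAdjoint A) (y : H) :
    inner ℂ y (A y) = (A.reApplyInnerSelf y : ℂ) := by
  exact (hA.isSymmetric y y).symm.trans (hA.isSymmetric.coe_reApplyInnerSelf_apply y).symm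

/-- Pairing with `y` gives `⟨Ay, y⟩ = z ⟨Ry, y⟩`, where both forms are real and the left side is
positive. The first conclusion makes eigenvalues real; the second excludes associated vectors. -/
theorem exists_real_of_apply_eq_smul {A R : H →L[ℂ] H} (hA : IsSelfAdjoint A)
    (hpos : IsPositiveOperator A) (hR : IsSelfAdjoint R) {z : ℂ} {y : H} (hy : y ≠ 0)
    (h : A y = z • R y) : (∃ t : ℝ, (t : ℂ) = z) ∧ inner ℂ y (R y) ≠ 0 := by
  have h1 := congrArg (inner ℂ y) h
  rw [inner_smul_right, inner_apply_self_eq_ofReal hA, inner_apply_self_eq_ofReal hR] at h1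
  have h2 := hpos y hy
  have h3 : R.reApplyInnerSelf y ≠ 0 := fun h0 => by
    rw [h0] at h1
    simp at h1
    exact h2.ne' h1
  refine ⟨⟨A.reApplyInnerSelf y / R.reApplyInnerSelf y, ?_⟩, ?_⟩
  · push_cast
    rw [h1, mul_div_assoc, div_self (by exact_mod_cast h3), mul_one]
  · rw [inner_apply_self_eq_ofReal hR]
    exact_mod_cast h3

theorem IsPositiveOperator.nonneg {A : H →L[ℂ] H} (hA : IsSelfAdjoint A)
    (hpos : IsPositiveOperator A) : 0 ≤ A := by
  rw [ContinuousLinearMap.nonneg_iff_isPositive, ContinuousLinearMap.isPositive_def']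
  refine ⟨hA, fun x => ?_⟩
  rcases eq_or_ne x 0 with rfl | hx
  · simp [ContinuousLinearMap.reApplyInnerSelf_apply]
  · exact (hpos x hx).le

/-- Congruence by `S = √A` turns `A - R` into `1 - K` with `K = S⁻¹ R S⁻¹` and keeps the index. The
map `S` carries the kernel of `A - s R` onto the eigenspace of `K` at `1/s`, so `s` in `(0, 1)`
corresponds to eigenvalues above `1`. -/
theorem finite_and_inertia_sub {A R : H →L[ℂ] H} (hA : IsSelfAdjoint A)
    (hpos : IsPositiveOperator A) (hu : IsUnit A) (hR : IsSelfAdjoint R)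
    (hRc : IsCompactOperator R)
    (h1 : ∀ s ∈ Set.Ioo (0 : ℝ) 1, finrank ℂ (A - (s : ℂ) • R).ker ≤ 1) :
    {s : ℝ | s ∈ Set.Ioo (0 : ℝ) 1 ∧ (A - (s : ℂ) • R).ker ≠ ⊥}.Finite ∧
      inertia (A - R)
        = ({s : ℝ | s ∈ Set.Ioo (0 : ℝ) 1 ∧ (A - (s : ℂ) • R).ker ≠ ⊥}.ncard : ℕ∞) := by
  have hnn := hpos.nonneg hA
  have hSu : IsUnit (CFC.sqrt A) := (CFC.isUnit_sqrt_iff A).2 hu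
  have hSS : CFC.sqrt A * CFC.sqrt A = A := CFC.sqrt_mul_sqrt_self A
  have hSs : IsSelfAdjoint (CFC.sqrt A) := (CFC.sqrt_nonneg A).isSelfAdjoint
  let S : H ≃L[ℂ] H := ContinuousLinearEquiv.unitsEquiv ℂ H hSu.unit
  have hS : ∀ x, CFC.sqrt A x = S x := fun x => rfl
  have hA' : ∀ x, A x = S (S x) := fun x => by
    conv_lhs => rw [← hSS]
    rfl
  have hsym : ∀ x y, inner ℂ (S x) y = inner ℂ x (S y) := fun x y => hSs.isSymmetric x y
  have hsym' : ∀ x y, inner ℂ (S.symm x) y = inner ℂ x (S.symm y) := fun x y => by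
    rw [← S.apply_symm_apply y, ← hsym]; simp
  let K : H →L[ℂ] H := (S.symm : H →L[ℂ] H) ∘L R ∘L (S.symm : H →L[ℂ] H)
  have hK : ∀ x, K x = S.symm (R (S.symm x)) := fun x => rfl
  have hKc : IsCompactOperator K :=
    (hRc.comp_clm (S.symm : H →L[ℂ] H)).clm_comp (S.symm : H →L[ℂ] H)
  have hKs : IsSelfAdjoint K := ContinuousLinearMap.isSelfAdjoint_iff_isSymmetric.2 fun x y => by
    simp only [ContinuousLinearMap.coe_coe]
    rw [hK, hK, hsym', ← hsym' x]
    exact hR.isSymmetric _ _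
  have hev : ∀ s : ℝ, s ≠ 0 → eigenspace (K : End ℂ H) ((s⁻¹ : ℝ) : ℂ)
      = (A - (s : ℂ) • R).ker.map (S.toLinearEquiv : H →ₗ[ℂ] H) := by
    intro s hs
    have hs' : (s : ℂ) ≠ 0 := by exact_mod_cast hs
    ext x
    rw [mem_eigenspace_iff, ContinuousLinearMap.coe_coe, Submodule.mem_map_equiv,
      LinearMap.mem_ker, ContinuousLinearMap.coe_coe, sub_apply, smul_apply, sub_eq_zero, hA', hK]
    have e1 : S.toLinearEquiv.symm x = S.symm x := rfl
    rw [e1, S.apply_symm_apply, S.symm_apply_eq, map_smul,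
      Complex.ofReal_inv, eq_inv_smul_iff₀ hs', eq_comm]
  have hfr : ∀ s : ℝ, s ≠ 0 → finrank ℂ (eigenspace (K : End ℂ H) ((s⁻¹ : ℝ) : ℂ))
      = finrank ℂ (A - (s : ℂ) • R).ker := fun s hs => by
    rw [hev s hs]
    exact LinearEquiv.finrank_map_eq _ _
  have hset : {μ : ℝ | 1 < μ ∧ HasEigenvalue (K : End ℂ H) (μ : ℂ)}
      = (fun s => s⁻¹) '' {s : ℝ | s ∈ Set.Ioo (0 : ℝ) 1 ∧ (A - (s : ℂ) • R).ker ≠ ⊥} := by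
    ext μ
    constructor
    · rintro ⟨hμ, hμ'⟩
      have h0 : 0 < μ := zero_lt_one.trans hμ
      refine ⟨μ⁻¹, ⟨⟨inv_pos.2 h0, inv_lt_one_of_one_lt₀ hμ⟩, ?_⟩, inv_inv μ⟩
      intro h
      refine hμ' ?_
      have := hev μ⁻¹ (inv_ne_zero h0.ne')
      rw [h, Submodule.map_bot, inv_inv] at this
      exact this
    · rintro ⟨s, ⟨hs, hs'⟩, rfl⟩
      refine ⟨(one_lt_inv₀ hs.1).2 hs.2, fun h => hs' ?_⟩
      have h2 : eigenspace (K : End ℂ H) ((s⁻¹ : ℝ) : ℂ) = ⊥ := h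
      rw [hev s hs.1.ne'] at h2
      exact Submodule.map_eq_bot_iff.1 h2
  have hinj : Function.Injective (fun s : ℝ => s⁻¹) := inv_injective
  refine ⟨(hset ▸ finite_setOf_hasEigenvalue_gt_one hKc hKs).of_finite_image hinj.injOn, ?_⟩
  have hmain := inertia_one_sub hKc hKs fun μ hμ => by
    have h0 : 0 < μ := zero_lt_one.trans hμ
    have := hfr μ⁻¹ (inv_ne_zero h0.ne')
    rw [inv_inv] at this
    rw [this]
    exact h1 _ ⟨inv_pos.2 h0, inv_lt_one_of_one_lt₀ hμ⟩
  rw [hset, Set.ncard_image_of_injective _ hinj] at hmain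
  rw [← hmain, inertia, inertia, ← formIndex_comp (1 - K).reApplyInnerSelf S]
  congr 1
  ext x
  have hx : (A - R) x = S ((1 - K) (S x)) := by
    rw [sub_apply, sub_apply, hK, map_sub, S.apply_symm_apply, S.symm_apply_apply,
      one_apply_eq_self, hA']
  rw [Function.comp_apply, ContinuousLinearMap.reApplyInnerSelf_apply,
    ContinuousLinearMap.reApplyInnerSelf_apply, hx, hsym]

/-- The points at which the real pencil `A - (x - ξ) R` degenerates. -/
def realSpectrum (A R : H →L[ℂ] H) (ξ : ℝ) : Set ℝ :=
  {x : ℝ | (A - ((x - ξ : ℝ) : ℂ) • R).ker ≠ ⊥}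

/-- Scaling `R` by a real `t` of either sign treats the points to the right and to the left of `ξ`
together. -/
theorem finite_and_inertia_sub_smul {A R : H →L[ℂ] H} {ξ : ℝ} (hA : IsSelfAdjoint A)
    (hpos : IsPositiveOperator A) (hu : IsUnit A) (hR : IsSelfAdjoint R)
    (hRc : IsCompactOperator R)
    (h1 : ∀ x : ℝ, finrank ℂ (A - ((x - ξ : ℝ) : ℂ) • R).ker ≤ 1) (t : ℝ) :
    {s : ℝ | s ∈ Set.Ioo 0 1 ∧ ξ + s * t ∈ realSpectrum A R ξ}.Finite ∧
      inertia (A - (t : ℂ) • R)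
        = ({s : ℝ | s ∈ Set.Ioo 0 1 ∧ ξ + s * t ∈ realSpectrum A R ξ}.ncard : ℕ∞) := by
  have hR' : IsSelfAdjoint ((t : ℂ) • R) := by
    rw [isSelfAdjoint_iff, star_smul, hR.star_eq]; simp
  have key : ∀ s : ℝ, A - (s : ℂ) • (t : ℂ) • R = A - ((ξ + s * t - ξ : ℝ) : ℂ) • R := by
    intro s
    rw [smul_smul, add_sub_cancel_left]; push_cast; rfl
  have := finite_and_inertia_sub hA hpos hu hR' (hRc.smul (t : ℂ)) (fun s _ => by
    rw [key]; exact h1 _)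
  simp only [key] at this
  exact this

/-! ### Enumeration of discrete subsets of the line. -/

/-- The counting function `c t = #(P ∩ (-∞, t])` is strictly increasing on `P`, and its values form
an initial segment of the positive integers, since the predecessor of a point has count one less.
The enumeration is its inverse. -/
theorem exists_strictMonoOn_enumeration {P : Set ℝ} (hfin : ∀ t, (P ∩ Set.Iic t).Finite) :
    ∃ (N : ℕ∞) (f : ℕ → ℝ), f '' {n | 0 < n ∧ (n : ℕ∞) ≤ N} = P ∧
      StrictMonoOn f {n | 0 < n ∧ (n : ℕ∞) ≤ N} ∧
      ∀ n : ℕ, 0 < n → (n : ℕ∞) ≤ N → (P ∩ Set.Iio (f n)).ncard = n - 1 := by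
  let c : ℝ → ℕ := fun t => (P ∩ Set.Iic t).ncard
  have hlt : ∀ t ∈ P, c t = (P ∩ Set.Iio t).ncard + 1 := by
    intro t ht
    have : P ∩ Set.Iic t = insert t (P ∩ Set.Iio t) := by
      ext x
      simp only [Set.mem_inter_iff, Set.mem_Iic, Set.mem_insert_iff, Set.mem_Iio, le_iff_lt_or_eq]
      constructor
      · rintro ⟨h, h' | h'⟩ <;> tauto
      · rintro (rfl | h) <;> tauto
    change (P ∩ Set.Iic t).ncard = _
    rw [this, Set.ncard_insert_of_notMem (by simp)
      ((hfin t).subset (Set.inter_subset_inter_right _ Set.Iio_subset_Iic_self))]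
  have hmono : ∀ s ∈ P, ∀ t ∈ P, s < t → c s < c t := by
    intro s hs t ht hst
    refine Set.ncard_lt_ncard ?_ (hfin t)
    refine ⟨Set.inter_subset_inter_right _ (Set.Iic_subset_Iic.2 hst.le), fun h => ?_⟩
    exact (h ⟨ht, le_refl t⟩).2.not_gt hst
  have hinj : ∀ s ∈ P, ∀ t ∈ P, c s = c t → s = t := by
    intro s hs t ht h
    rcases lt_trichotomy s t with h' | h' | h'
    · exact absurd h (hmono s hs t ht h').ne
    · exact h'
    · exact absurd h (hmono t ht s hs h').ne'
  have hpred : ∀ n, ∀ t ∈ P, c t = n + 2 → ∃ s ∈ P, c s = n + 1 := by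
    intro n t ht h
    have h1 := hlt t ht
    have hf : (P ∩ Set.Iio t).Finite :=
      (hfin t).subset (Set.inter_subset_inter_right _ Set.Iio_subset_Iic_self)
    have hne : (P ∩ Set.Iio t).Nonempty := by
      rw [← Set.ncard_pos hf]; omega
    obtain ⟨s, hs, hmax⟩ := Set.exists_max_image _ id hf hne
    refine ⟨s, hs.1, ?_⟩
    have : P ∩ Set.Iic s = P ∩ Set.Iio t := by
      ext x
      exact ⟨fun h => ⟨h.1, (show x ≤ s from h.2).trans_lt hs.2⟩, fun h => ⟨h.1, hmax x h⟩⟩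
    change (P ∩ Set.Iic s).ncard = _
    rw [this]; omega
  have hdown : ∀ k n, ∀ t ∈ P, c t = n + 1 + k → ∃ s ∈ P, c s = n + 1 := by
    intro k
    induction k with
    | zero => exact fun n t ht h => ⟨t, ht, h⟩
    | succ k ih =>
      intro n t ht h
      obtain ⟨s, hs, h'⟩ := hpred (n + k) t ht (by omega)
      exact ih n s hs (by omega)
  -- The number of terms: zero for empty `P`, `⊤` for infinite `P`.
  let N : ℕ∞ := ⨆ t : P, (c t : ℕ∞)
  have hex : ∀ n : ℕ, 0 < n → (n : ℕ∞) ≤ N → ∃ t ∈ P, c t = n := by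
    intro n hn hN
    by_contra! hcon
    have hle : N ≤ ((n - 1 : ℕ) : ℕ∞) := by
      refine iSup_le fun t => ?_
      norm_cast
      by_contra! hgt
      obtain ⟨s, hs, h⟩ := hdown (c t - n) (n - 1) t t.2 (by omega)
      exact hcon s hs (by omega)
    have := hN.trans hle
    norm_cast at this
    omega
  choose! f hf1 hf2 using hex
  have hleft : ∀ t ∈ P, 0 < c t ∧ (c t : ℕ∞) ≤ N := fun t ht =>
    ⟨by rw [hlt t ht]; omega, le_iSup (fun t : P => (c t : ℕ∞)) ⟨t, ht⟩⟩
  refine ⟨N, f, ?_, ?_, ?_⟩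
  · ext t
    constructor
    · rintro ⟨n, ⟨hn, hN⟩, rfl⟩
      exact hf1 n hn hN
    · intro ht
      obtain ⟨h1, h2⟩ := hleft t ht
      exact ⟨c t, ⟨h1, h2⟩, hinj _ (hf1 _ h1 h2) _ ht (hf2 _ h1 h2)⟩
  · rintro m ⟨hm, hmN⟩ n ⟨hn, hnN⟩ hmn
    by_contra! hle
    rcases hle.lt_or_eq with h | h
    · have := hmono _ (hf1 n hn hnN) _ (hf1 m hm hmN) h
      rw [hf2 n hn hnN, hf2 m hm hmN] at this
      omega
    · have := hf2 n hn hnN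
      rw [h, hf2 m hm hmN] at this
      omega
  · intro n hn hN
    have := hlt _ (hf1 n hn hN)
    rw [hf2 n hn hN] at this
    omega

theorem not_accPt_of_finite_inter_Icc {S : Set ℝ} (h : ∀ a b, (S ∩ Set.Icc a b).Finite) (x : ℝ) :
    ¬ AccPt x (Filter.principal S) := by
  rw [accPt_iff_frequently, Filter.not_frequently]
  have hF : ((S ∩ Set.Icc (x - 1) (x + 1)) \ {x}).Finite := (h _ _).subset Set.sdiff_subset
  filter_upwards [hF.isClosed.isOpen_compl.mem_nhds (by simp : x ∈ _),
    Icc_mem_nhds (sub_one_lt x) (lt_add_one x)] with y hy hy' hc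
  exact hy ⟨⟨hc.2, hy'⟩, hc.1⟩

/-- The part of `S` below `ξ` is reflected, so that it too is enumerated moving away from `ξ`. -/
theorem exists_two_sided_enumeration {S : Set ℝ} {ξ : ℝ} (hξ : ξ ∉ S)
    (hfin : ∀ a b, (S ∩ Set.Icc a b).Finite) :
    ∃ (Nneg Npos : ℕ∞) (lam : ℤ → ℝ) (J : Set ℤ),
      J = {n : ℤ | (0 < n ∧ (n.natAbs : ℕ∞) ≤ Npos) ∨ (n < 0 ∧ (n.natAbs : ℕ∞) ≤ Nneg)} ∧
      lam '' J = S ∧ StrictMonoOn lam J ∧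
      (∀ n ∈ J, 0 < n → ξ < lam n ∧ (S ∩ Set.Ioo ξ (lam n)).ncard = n.natAbs - 1) ∧
      (∀ n ∈ J, n < 0 → lam n < ξ ∧ (S ∩ Set.Ioo (lam n) ξ).ncard = n.natAbs - 1) := by
  obtain ⟨Np, f, hfP, hfm, hfc⟩ := exists_strictMonoOn_enumeration (P := S ∩ Set.Ioi ξ)
    (fun t => (hfin ξ t).subset fun x hx => ⟨hx.1.1, hx.1.2.le, hx.2⟩)
  obtain ⟨Nn, g, hgP, hgm, hgc⟩ :=
    exists_strictMonoOn_enumeration (P := (fun x => -x) ⁻¹' (S ∩ Set.Iio ξ))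
    (fun t => ((hfin (-t) ξ).preimage neg_injective.injOn).subset fun x hx =>
      ⟨hx.1.1, neg_le_neg hx.2, le_of_lt hx.1.2⟩)
  let lam : ℤ → ℝ := fun n => if 0 < n then f n.natAbs else -g n.natAbs
  have hpos : ∀ n : ℤ, 0 < n → lam n = f n.natAbs := fun n hn => if_pos hn
  have hneg : ∀ n : ℤ, n < 0 → lam n = -g n.natAbs := fun n hn => if_neg hn.not_gt
  have hf : ∀ n : ℕ, 0 < n → (n : ℕ∞) ≤ Np → f n ∈ S ∩ Set.Ioi ξ := fun n h1 h2 => by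
    rw [← hfP]; exact ⟨n, ⟨h1, h2⟩, rfl⟩
  have hg : ∀ n : ℕ, 0 < n → (n : ℕ∞) ≤ Nn → -g n ∈ S ∩ Set.Iio ξ := fun n h1 h2 => by
    have : g n ∈ (fun x => -x) ⁻¹' (S ∩ Set.Iio ξ) := by rw [← hgP]; exact ⟨n, ⟨h1, h2⟩, rfl⟩
    exact this
  refine ⟨Nn, Np, lam, _, rfl, ?_, ?_, ?_, ?_⟩
  · ext x
    constructor
    · rintro ⟨n, ⟨hn, hN⟩ | ⟨hn, hN⟩, rfl⟩
      · rw [hpos n hn]; exact (hf _ (by omega) hN).1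
      · rw [hneg n hn]; exact (hg _ (by omega) hN).1
    · intro hx
      rcases lt_trichotomy x ξ with h | h | h
      · have : -x ∈ (fun x => -x) ⁻¹' (S ∩ Set.Iio ξ) := by
          simpa using ⟨hx, h⟩
        rw [← hgP] at this
        obtain ⟨n, ⟨h1, h2⟩, h3⟩ := this
        refine ⟨-(n : ℤ), Or.inr ⟨by omega, by simpa using h2⟩, ?_⟩
        rw [hneg _ (by omega), Int.natAbs_neg, Int.natAbs_natCast, h3, neg_neg]
      · exact absurd (h ▸ hx) hξ
      · have : x ∈ S ∩ Set.Ioi ξ := ⟨hx, h⟩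
        rw [← hfP] at this
        obtain ⟨n, ⟨h1, h2⟩, h3⟩ := this
        refine ⟨(n : ℤ), Or.inl ⟨by omega, by simpa using h2⟩, ?_⟩
        rw [hpos _ (by omega), Int.natAbs_natCast, h3]
  · rintro m (⟨hm, hmN⟩ | ⟨hm, hmN⟩) n (⟨hn, hnN⟩ | ⟨hn, hnN⟩) hmn
    · rw [hpos m hm, hpos n hn]
      exact hfm ⟨by omega, hmN⟩ ⟨by omega, hnN⟩ (by omega)
    · omega
    · rw [hneg m hm, hpos n hn]
      exact (hg _ (by omega) hmN).2.trans (hf _ (by omega) hnN).2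
    · rw [hneg m hm, hneg n hn]
      exact neg_lt_neg (hgm ⟨by omega, hnN⟩ ⟨by omega, hmN⟩ (by omega))
  · rintro n (⟨hn, hN⟩ | ⟨hn, hN⟩) hn'
    · rw [hpos n hn, ← hfc _ (by omega) hN]
      refine ⟨(hf _ (by omega) hN).2, ?_⟩
      congr 1
      ext x
      simp only [Set.mem_inter_iff, Set.mem_Ioo, Set.mem_Ioi, Set.mem_Iio, and_assoc]
    · omega
  · rintro n (⟨hn, hN⟩ | ⟨hn, hN⟩) hn'
    · omega
    · rw [hneg n hn, ← hgc _ (by omega) hN]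
      refine ⟨(hg _ (by omega) hN).2, ?_⟩
      rw [← Set.ncard_image_of_injective _ neg_injective]
      congr 1
      ext x
      simp only [Set.mem_image, Set.mem_inter_iff, Set.mem_preimage, Set.mem_Ioo, Set.mem_Iio]
      constructor
      · rintro ⟨y, ⟨h1, h2, h3⟩, rfl⟩
        exact ⟨⟨by simpa using h1, by simpa using h3⟩, by linarith⟩
      · rintro ⟨⟨h1, h2⟩, h3⟩
        exact ⟨-x, ⟨h1, by linarith, h2⟩, neg_neg x⟩

end OperatorPencil

/-! ### Compactness of the Sobolev embedding and estimates for `W₂⁻¹` coefficients. -/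

/-- A finite net for the image of the unit ball under `S`, pulled back to the ball, is a net for its
image under `T`, up to an error controlled by `ε`. -/
theorem isCompactOperator_of_forall_norm_le {E F : Type*} [NormedAddCommGroup E] [NormedSpace ℂ E]
    [NormedAddCommGroup F] [NormedSpace ℂ F] [CompleteSpace F] (T : E →L[ℂ] F)
    (h : ∀ ε > 0, ∃ (G : Type) (_ : NormedAddCommGroup G) (_ : NormedSpace ℂ G) (S : E →L[ℂ] G),
      IsCompactOperator S ∧ ∀ u, ‖T u‖ ≤ ε * ‖u‖ + ‖S u‖) : IsCompactOperator T := by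
  refine (isCompactOperator_iff_isCompact_closure_image_ball (T : E →ₗ[ℂ] F) one_pos).2 ?_
  refine TotallyBounded.isCompact_of_isClosed (TotallyBounded.closure ?_) isClosed_closure
  rw [Metric.totallyBounded_iff]
  intro ε hε
  -- Two points of the unit ball are less than `2` apart, so the first term costs at most `ε/2` and
  -- the net for `S` the other half.
  obtain ⟨G, _, _, S, hS, hTS⟩ := h (ε / 4) (by positivity)
  obtain ⟨C, hC, hC'⟩ := hS.image_ball_subset_compact 1
  obtain ⟨t, hts, htf, ht⟩ :=
    Metric.finite_approx_of_totallyBounded (hC.totallyBounded.subset hC') (ε / 2) (half_pos hε)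
  obtain ⟨t', ht's, ht'f, rfl⟩ : ∃ t' ⊆ Metric.ball (0 : E) 1, t'.Finite ∧ S '' t' = t := by
    obtain ⟨t', h1, h2, h3⟩ := Set.exists_subset_image_finite_and.1 ⟨t, hts, htf, (rfl : t = t)⟩
    exact ⟨t', h1, h2, h3.symm⟩
  refine ⟨T '' t', ht'f.image _, ?_⟩
  rintro _ ⟨u, hu, rfl⟩
  obtain ⟨_, ⟨w, hw, rfl⟩, hw'⟩ := Set.mem_iUnion₂.1 (ht ⟨u, hu, rfl⟩)
  refine Set.mem_iUnion₂.2 ⟨T w, ⟨w, hw, rfl⟩, ?_⟩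
  have h1 : ‖u‖ < 1 := by simpa using hu
  have h2 : ‖w‖ < 1 := by simpa using ht's hw
  have h3 : ‖S (u - w)‖ < ε / 2 := by
    rw [map_sub, ← dist_eq_norm]; exact hw'
  have h4 := hTS (u - w)
  have h5 : ‖u - w‖ < 2 := (norm_sub_le _ _).trans_lt (by linarith)
  rw [Metric.mem_ball, dist_eq_norm]
  change ‖T u - T w‖ < ε
  rw [← map_sub]
  nlinarith

namespace SturmLiouville

theorem norm_integral_mul_L2_le (g : L2I) {φ : ℝ → ℝ} (hφ : Continuous φ) {a b : ℝ}
    (ha : 0 ≤ a) (hab : a ≤ b) (hb : b ≤ 1) :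
    ‖∫ t in a..b, (φ t : ℂ) * g t‖ ≤ √(∫ t in a..b, φ t ^ 2) * ‖g‖ := by
  have hsub : Set.Ioc a b ⊆ Set.Icc 0 1 := fun t ht => ⟨ha.trans ht.1.le, ht.2.trans hb⟩
  have hφm : MemLp (fun t => (φ t : ℂ)) (ENNReal.ofReal 2) (volume.restrict (Set.Ioc a b)) := by
    obtain ⟨C, hC⟩ := isCompact_Icc.exists_bound_of_continuousOn (hφ.continuousOn (s := Set.Icc a b))
    exact MemLp.of_bound
      (Complex.continuous_ofReal.comp hφ).aestronglyMeasurable C ((ae_restrict_iff' measurableSet_Ioc).2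
      (Filter.Eventually.of_forall fun t ht => by
        simpa using hC t (Set.Ioc_subset_Icc_self ht)))
  have hgm : MemLp g (ENNReal.ofReal 2) (volume.restrict (Set.Ioc a b)) := by
    have := (Lp.memLp g).mono_measure (Measure.restrict_mono_set volume hsub)
    simpa using this
  have h1 : ∫ t in Set.Ioc a b, ‖g t‖ ^ (2 : ℝ) ≤ ‖g‖ ^ 2 := by
    have h2 : ‖g‖ ^ 2 = ∫ t, ‖g t‖ ^ (2 : ℝ) ∂μI := by
      rw [← inner_self_eq_norm_sq (𝕜 := ℂ), L2.inner_def, ← integral_re (L2.integrable_inner g g)]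
      refine integral_congr_ae (Filter.Eventually.of_forall fun t => ?_)
      simp [← inner_self_eq_norm_sq (𝕜 := ℂ)]
    rw [h2]
    refine setIntegral_mono_set ?_ (Filter.Eventually.of_forall fun t => by positivity)
      hsub.eventuallyLE
    have := (Lp.memLp g).integrable_norm_rpow (by norm_num) (by norm_num)
    simpa [IntegrableOn] using this
  rw [intervalIntegral.integral_of_le hab, intervalIntegral.integral_of_le hab]
  refine (norm_integral_le_integral_norm _).trans ?_
  have := integral_mul_norm_le_Lp_mul_Lq Real.HolderConjugate.two_two hφm hgm
  simp only [norm_mul, Complex.norm_real] at this ⊢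
  refine this.trans ?_
  rw [← Real.sqrt_eq_rpow, ← Real.sqrt_eq_rpow]
  have h3 : ∀ t, ‖φ t‖ ^ (2 : ℝ) = φ t ^ 2 := fun t => by simp
  simp only [h3]
  exact mul_le_mul_of_nonneg_left (Real.sqrt_le_iff.2 ⟨norm_nonneg _, h1⟩) (Real.sqrt_nonneg _)

theorem rep_sub_rep (u : W21) {a b : ℝ} (ha : a ∈ Set.Icc (0 : ℝ) 1) (hb : b ∈ Set.Icc (0 : ℝ) 1) :
    rep u b - rep u a = ∫ t in a..b, D u t := by
  rw [rep, rep, add_sub_add_left_eq_sub]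
  exact intervalIntegral.integral_interval_sub_left (intervalIntegrable_L2' _ hb)
    (intervalIntegrable_L2' _ ha)

theorem norm_rep_sub_rep_le (u : W21) {a b : ℝ} (ha : 0 ≤ a) (hab : a ≤ b) (hb : b ≤ 1) :
    ‖rep u b - rep u a‖ ≤ √(b - a) * ‖u‖ := by
  rw [rep_sub_rep u ⟨ha, hab.trans hb⟩ ⟨ha.trans hab, hb⟩]
  have := norm_integral_mul_L2_le (D u) (φ := fun _ => 1) continuous_const ha hab hb
  simp only [Complex.ofReal_one, one_mul, one_pow, intervalIntegral.integral_const, smul_eq_mul,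
    mul_one] at this
  exact this.trans (by gcongr; exact norm_D_le u)

theorem norm_L2_le_of_ae_bound (f : L2I) {C : ℝ} (hC : 0 ≤ C) (h : ∀ᵐ x ∂μI, ‖f x‖ ≤ C) :
    ‖f‖ ≤ C := by
  have := Lp.norm_le_of_ae_bound hC h
  have h1 : measureUnivNNReal μI = 1 := by
    rw [measureUnivNNReal, measure_univ]; rfl
  rw [h1] at this
  simpa using this

/-- Sampling at the nodes `k/n` has finite rank, and the Hölder bound `|u(b) - u(a)| ≤ √(b - a) ‖u‖`
controls `u` between nodes by `n^{-1/2} ‖u‖`. -/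
theorem isCompactOperator_toL2 : IsCompactOperator toL2 := by
  refine isCompactOperator_of_forall_norm_le toL2 fun ε hε => ?_
  obtain ⟨n, hn⟩ := exists_nat_gt (1 / ε ^ 2)
  have hn0 : (0 : ℝ) < n := lt_trans (by positivity) hn
  have hmem : ∀ k : Fin (n + 1), ((k : ℕ) / n : ℝ) ∈ Set.Icc (0 : ℝ) 1 := fun k =>
    ⟨by positivity, (div_le_one hn0).2 (by exact_mod_cast Nat.lt_succ_iff.1 k.2)⟩
  refine ⟨Fin (n + 1) → ℂ, inferInstance, inferInstance,
    ContinuousLinearMap.pi fun k => evalAt ⟨_, hmem k⟩,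
    isCompactOperator_of_locallyCompactSpace_dom _, fun u => ?_⟩
  set S : W21 →L[ℂ] (Fin (n + 1) → ℂ) := ContinuousLinearMap.pi fun k => evalAt ⟨_, hmem k⟩
  refine norm_L2_le_of_ae_bound _ (by positivity) ?_
  filter_upwards [toL2_ae u, ae_mem_Icc] with x hx hxI
  rw [hx]
  have hfl := Nat.floor_le (mul_nonneg hn0.le hxI.1)
  have hlt := Nat.lt_floor_add_one ((n : ℝ) * x)
  let k : Fin (n + 1) := ⟨⌊(n : ℝ) * x⌋₊, Nat.lt_succ_of_le (Nat.floor_le_of_le (by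
    nlinarith [hxI.2]))⟩
  have hk1 : ((k : ℕ) / n : ℝ) ≤ x := by rw [div_le_iff₀ hn0]; linarith
  have hk2 : x - ((k : ℕ) / n : ℝ) ≤ ε ^ 2 := by
    have h1 : x - ((k : ℕ) / n : ℝ) ≤ 1 / n := by
      rw [sub_le_iff_le_add, ← add_div, le_div_iff₀ hn0]
      change x * n ≤ 1 + (⌊(n : ℝ) * x⌋₊ : ℝ)
      linarith
    refine h1.trans ?_
    rw [div_le_iff₀ hn0]
    rw [div_lt_iff₀ (by positivity)] at hn
    linarith
  have h2 : ‖rep u (k / n)‖ ≤ ‖S u‖ := norm_le_pi_norm (S u) k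
  have h3 := norm_rep_sub_rep_le u (hmem k).1 hk1 hxI.2
  have h4 : √(x - ((k : ℕ) / n : ℝ)) ≤ ε := Real.sqrt_le_iff.2 ⟨hε.le, hk2⟩
  calc ‖rep u x‖ = ‖(rep u x - rep u (k / n)) + rep u (k / n)‖ := by rw [sub_add_cancel]
    _ ≤ √(x - ((k : ℕ) / n : ℝ)) * ‖u‖ + ‖S u‖ := (norm_add_le _ _).trans (add_le_add h3 h2)
    _ ≤ ε * ‖u‖ + ‖S u‖ := by gcongr

theorem denseRange_adjoint_toL2 : DenseRange toL2.adjoint := by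
  have h := toL2.adjoint.orthogonal_range
  rw [ContinuousLinearMap.adjoint_adjoint, LinearMap.ker_eq_bot.2 toL2_injective] at h
  have h2 := (Submodule.topologicalClosure_eq_top_iff (K := toL2.adjoint.range)).2 h
  exact Submodule.dense_iff_topologicalClosure_eq_top.2 h2

/-- The Riesz vector of `s` is approximated by `toL2.adjoint g` with `g` in `L₂`. The error meets
the `W₂¹` norm of `y z̄`, the main part only its `L₂` norm. The small term thus makes forms with
distributional coefficients relatively compact. -/
theorem exists_norm_mulConj_le (s : W21 →L[ℂ] ℂ) {ε : ℝ} (hε : 0 < ε) :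
    ∃ C, 0 ≤ C ∧ ∀ z y, ‖s (mulConj z y)‖ ≤ (ε * ‖y‖ + C * ‖toL2 y‖) * ‖z‖ := by
  let v := (InnerProductSpace.toDual ℂ W21).symm s
  have hv : ∀ w, s w = inner ℂ v w := fun w => by
    rw [InnerProductSpace.toDual_symm_apply]
  -- The `9` is the constant in `‖y z̄‖ ≤ 9 ‖z‖ ‖y‖`.
  obtain ⟨g, hg⟩ := denseRange_adjoint_toL2.exists_dist_lt v (show 0 < ε / 9 by positivity)
  refine ⟨3 * ‖g‖, by positivity, fun z y => ?_⟩
  have h1 : s (mulConj z y) = inner ℂ (v - toL2.adjoint g) (mulConj z y)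
      + inner ℂ g (mulConjFst z y) := by
    rw [inner_sub_left, ContinuousLinearMap.adjoint_inner_left, hv]
    exact (sub_add_cancel _ _).symm
  rw [dist_eq_norm] at hg
  rw [h1]
  have h2 : ‖mulConjFst z y‖ ≤ 3 * ‖z‖ * ‖toL2 y‖ := norm_mulBdd_le _ _ _ _ _
  calc _ ≤ ‖v - toL2.adjoint g‖ * ‖mulConj z y‖ + ‖g‖ * ‖mulConjFst z y‖ :=
        (norm_add_le _ _).trans (add_le_add (norm_inner_le_norm _ _) (norm_inner_le_norm _ _))
    _ ≤ ε / 9 * (9 * ‖z‖ * ‖y‖) + ‖g‖ * (3 * ‖z‖ * ‖toL2 y‖) := by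
        gcongr; exact norm_mulConj_le z y
    _ = _ := by ring

theorem IsRealFunctional.apply_mulConj_comm {q : W21 →L[ℂ] ℂ} (hq : IsRealFunctional q)
    (z y : W21) : q (mulConj y z) = conj (q (mulConj z y)) := by
  set a := mulConj z y with ha
  set b := mulConj y z with hb
  have hab : ∀ x ∈ Set.Icc (0 : ℝ) 1, rep b x = conj (rep a x) := fun x hx => by
    rw [ha, hb, rep_mulConj _ _ hx, rep_mulConj _ _ hx, map_mul, Complex.conj_conj, mul_comm]
  have h1 := hq (a + b) fun x hx => by rw [rep_add _ _ hx, hab x hx]; simp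
  -- Both `y z̄ + z ȳ` and `i (y z̄ - z ȳ)` are real-valued, which yields the real and the imaginary
  -- part of the identity.
  have h2 := hq (Complex.I • (a + (-1 : ℂ) • b)) fun x hx => by
    rw [rep_smul _ _ hx, rep_add _ _ hx, rep_smul _ _ hx, hab x hx]; simp
  simp only [map_add, map_smul, smul_eq_mul, Complex.add_im, Complex.mul_im, Complex.I_re,
    Complex.I_im, zero_mul, zero_add, one_mul, Complex.add_re, Complex.neg_re,
    neg_mul] at h1 h2
  apply Complex.ext
  · rw [Complex.conj_re]; linarith
  · rw [Complex.conj_im]; linarith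

/-! ### Uniqueness for the weak Cauchy problem. -/

theorem exists_W21_of_D (g : L2I) (c : ℂ) :
    ∃ z : W21, D z = g ∧ ∀ x, rep z x = c + ∫ t in (0 : ℝ)..x, g t := by
  have hc : (volterra g + Lp.const 2 μI c : L2I) =ᵐ[μI] fun x => c + ∫ t in (0 : ℝ)..x, g t := by
    filter_upwards [Lp.coeFn_add (volterra g) (Lp.const 2 μI c), volterra_ae g,
      Lp.coeFn_const 2 μI c] with x h1 h2 h3
    rw [h1, Pi.add_apply, h2, h3, add_comm]; rfl
  let z : W21 := ⟨WithLp.toLp 2 (volterra g + Lp.const 2 μI c, g), c, hc⟩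
  exact ⟨z, rfl, fun x => rep_eq z c hc x⟩

theorem integral_exp_mul_le {κ : ℝ} (hκ : 0 < κ) {x : ℝ} :
    ∫ t in (0 : ℝ)..x, Real.exp (κ / 2 * t) ^ 2 ≤ Real.exp (κ * x) / κ := by
  have h : ∀ t, Real.exp (κ / 2 * t) ^ 2 = Real.exp (κ * t) := fun t => by
    rw [← Real.exp_nat_mul]; congr 1; push_cast; ring
  simp only [h]
  rw [intervalIntegral.integral_comp_mul_left _ hκ.ne', integral_exp, smul_eq_mul, mul_zero,
    Real.exp_zero, inv_mul_eq_div]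
  gcongr
  linarith

theorem integral_exp_neg_mul_le {κ : ℝ} (hκ : 0 < κ) {x : ℝ} :
    ∫ t in x..1, Real.exp (-(κ / 2) * t) ^ 2 ≤ Real.exp (-κ * x) / κ := by
  have h : ∀ t, Real.exp (-(κ / 2) * t) ^ 2 = Real.exp (-κ * t) := fun t => by
    rw [← Real.exp_nat_mul]; congr 1; push_cast; ring
  simp only [h]
  rw [intervalIntegral.integral_comp_mul_left _ (neg_ne_zero.2 hκ.ne'), integral_exp, smul_eq_mul,
    inv_neg, neg_mul, ← mul_neg, inv_mul_eq_div, neg_sub]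
  gcongr
  linarith [Real.exp_pos (-κ * 1)]

theorem sqrt_exp_div_sq {κ : ℝ} (hκ : 0 < κ) (a : ℝ) :
    √(Real.exp (κ ^ 2 * a) / κ ^ 2) = κ⁻¹ * Real.exp (κ ^ 2 / 2 * a) := by
  rw [show Real.exp (κ ^ 2 * a) / κ ^ 2 = (κ⁻¹ * Real.exp (κ ^ 2 / 2 * a)) ^ 2 by
    rw [mul_pow, ← Real.exp_nat_mul, inv_pow, inv_mul_eq_div]; congr 2; push_cast; ring]
  exact Real.sqrt_sq (by positivity)

/-- Multiplication by the weight `exp (a x)` on `L₂[0, 1]`. -/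
noncomputable def expWeight (a : ℝ) (g : L2I) : L2I :=
  mulBdd (fun x => (Real.exp (a * x) : ℂ)) (Real.exp |a|)
    (Complex.continuous_ofReal.comp (Real.continuous_exp.comp
      (continuous_const.mul continuous_id))).aestronglyMeasurable
    (by
      filter_upwards [ae_mem_Icc] with x hx
      rw [Complex.norm_real, Real.norm_eq_abs, Real.abs_exp]
      gcongr
      calc a * x ≤ |a| * x := by gcongr; exacts [hx.1, le_abs_self a]
        _ ≤ |a| := mul_le_of_le_one_right (abs_nonneg a) hx.2) g

theorem expWeight_ae (a : ℝ) (g : L2I) :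
    ∀ᵐ x ∂μI, expWeight a g x = (Real.exp (a * x) : ℂ) * g x :=
  mulBdd_ae _ _ _ _ g

theorem inner_expWeight_left (a : ℝ) (f g : L2I) :
    inner ℂ (expWeight a f) g = inner ℂ f (expWeight a g) := by
  rw [L2.inner_def, L2.inner_def]
  refine integral_congr_ae ?_
  filter_upwards [expWeight_ae a f, expWeight_ae a g] with x h1 h2
  rw [h1, h2, RCLike.inner_apply, RCLike.inner_apply, map_mul]
  rw [show (starRingEnd ℂ) ((Real.exp (a * x) : ℝ) : ℂ) = (Real.exp (a * x) : ℂ) from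
    Complex.conj_ofReal _]
  ring

theorem eq_expWeight_neg_mul {a : ℝ} {g : L2I} {x : ℝ}
    (h : expWeight a g x = (Real.exp (a * x) : ℂ) * g x) :
    g x = (Real.exp (-a * x) : ℂ) * expWeight a g x := by
  rw [h, ← mul_assoc, ← Complex.ofReal_mul, ← Real.exp_add]
  simp

/-- Cauchy–Schwarz after writing `g = exp(a t) · exp(-a t) g` with `a = κ²/2`. The factor `κ⁻¹` is
the gain: integration is small in the weighted norm. The exponent is taken as `κ²/2` so that the
square root is exact. -/
theorem norm_integral_zero_le_expWeight {κ : ℝ} (hκ : 0 < κ) (g : L2I) {x : ℝ}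
    (hx : x ∈ Set.Icc (0 : ℝ) 1) :
    ‖∫ t in (0 : ℝ)..x, g t‖
      ≤ κ⁻¹ * Real.exp (κ ^ 2 / 2 * x) * ‖expWeight (-(κ ^ 2 / 2)) g‖ := by
  have h1 : g =ᵐ[μI] fun t => (Real.exp (κ ^ 2 / 2 * t) : ℂ) * expWeight (-(κ ^ 2 / 2)) g t := by
    filter_upwards [expWeight_ae (-(κ ^ 2 / 2)) g] with t ht
    have := eq_expWeight_neg_mul ht
    rwa [neg_neg] at this
  rw [integral_congr_L2 h1 hx]
  refine (norm_integral_mul_L2_le _ (by fun_prop) le_rfl hx.1 hx.2).trans ?_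
  gcongr
  rw [← sqrt_exp_div_sq hκ]
  exact Real.sqrt_le_sqrt (integral_exp_mul_le (by positivity))

theorem norm_integral_one_expWeight_le {κ : ℝ} (hκ : 0 < κ) (f : L2I) {x : ℝ}
    (hx : x ∈ Set.Icc (0 : ℝ) 1) :
    ‖∫ t in x..1, expWeight (-(κ ^ 2 / 2)) f t‖
      ≤ κ⁻¹ * Real.exp (-(κ ^ 2 / 2) * x) * ‖f‖ := by
  have h1 := (ae_restrict_iff' measurableSet_Icc).1 (expWeight_ae (-(κ ^ 2 / 2)) f)
  have h2 : ∫ t in x..1, expWeight (-(κ ^ 2 / 2)) f t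
      = ∫ t in x..1, (Real.exp (-(κ ^ 2 / 2) * t) : ℂ) * f t := by
    refine intervalIntegral.integral_congr_ae ?_
    filter_upwards [h1] with t ht htx
    rw [Set.uIoc_of_le hx.2] at htx
    exact ht ⟨hx.1.trans htx.1.le, htx.2⟩
  rw [h2]
  refine (norm_integral_mul_L2_le _ (by fun_prop) hx.1 hx.2 le_rfl).trans ?_
  gcongr
  have := sqrt_exp_div_sq hκ (-x)
  rw [show κ ^ 2 * -x = -κ ^ 2 * x by ring, show κ ^ 2 / 2 * -x = -(κ ^ 2 / 2) * x by ring] at this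
  rw [← this]
  exact Real.sqrt_le_sqrt (integral_exp_neg_mul_le (by positivity))

theorem inner_W21 (v w : W21) :
    inner ℂ v w = inner ℂ (toL2 v) (toL2 w) + inner ℂ (D v) (D w) :=
  WithLp.prod_inner_apply (toPair v) (toPair w)

theorem mul_norm_le_norm_mulLinf {p : Lp ℝ ∞ μI} {c : ℝ} (hc : 0 < c) (hp : ∀ᵐ x ∂μI, c ≤ p x)
    (g : L2I) : c * ‖g‖ ≤ ‖mulLinf p g‖ := by
  have h : ‖g‖ ≤ c⁻¹ * ‖mulLinf p g‖ := by
    refine Lp.norm_le_mul_norm_of_ae_le_mul ?_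
    filter_upwards [hp, mulLinf_ae p g] with x h1 h2
    rw [h2, norm_mul, Complex.norm_real, ← mul_assoc, Real.norm_eq_abs]
    refine le_mul_of_one_le_left (norm_nonneg _) ?_
    rw [inv_mul_eq_div, one_le_div hc]
    exact h1.trans (le_abs_self _)
  rwa [inv_mul_eq_div, le_div_iff₀ hc, mul_comm] at h

theorem mulLinf_expWeight (p : Lp ℝ ∞ μI) (a : ℝ) (g : L2I) :
    mulLinf p (expWeight a g) = expWeight a (mulLinf p g) := by
  ext1
  filter_upwards [mulLinf_ae p (expWeight a g), mulLinf_ae p g, expWeight_ae a g,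
    expWeight_ae a (mulLinf p g)] with x h1 h2 h3 h4
  rw [h1, h3, h4, h2]; ring

theorem expWeight_add (a : ℝ) (f g : L2I) :
    expWeight a (f + g) = expWeight a f + expWeight a g := by
  ext1
  filter_upwards [expWeight_ae a (f + g), expWeight_ae a f, expWeight_ae a g,
    Lp.coeFn_add f g, Lp.coeFn_add (expWeight a f) (expWeight a g)] with x h1 h2 h3 h4 h5
  rw [h1, h4, h5, Pi.add_apply, Pi.add_apply, h2, h3]; ring

theorem norm_star_L2_le (g : L2I) : ‖star g‖ ≤ ‖g‖ := by
  refine Lp.norm_le_norm_of_ae_le ?_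
  filter_upwards [Lp.coeFn_star g] with x hx
  rw [hx, Pi.star_apply, norm_star]

theorem inner_mulBdd_star_comm (y : W21) (f g : L2I) :
    inner ℂ g (mulBdd (rep y) (3 * ‖y‖) (aesm_rep y) (ae_norm_rep_le y) (star f))
      = inner ℂ f (mulBdd (rep y) (3 * ‖y‖) (aesm_rep y) (ae_norm_rep_le y) (star g)) := by
  rw [L2.inner_def, L2.inner_def]
  refine integral_congr_ae ?_
  filter_upwards [mulBdd_ae _ _ (aesm_rep y) (ae_norm_rep_le y) (star f),
    mulBdd_ae _ _ (aesm_rep y) (ae_norm_rep_le y) (star g), Lp.coeFn_star f, Lp.coeFn_star g]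
    with x h1 h2 h3 h4
  rw [h1, h2, h3, h4, RCLike.inner_apply, RCLike.inner_apply, Pi.star_apply, Pi.star_apply]
  change _ * starRingEnd ℂ (f x) * starRingEnd ℂ (g x) = _ * starRingEnd ℂ (g x) * _
  ring

/-- Test functions need not vanish at `0`, so the weak equation also says that the quasi-derivative
at `0` is zero: this is uniqueness for zero Cauchy data. With `v` the Riesz vector of `s`, the
regularized quasi-derivative is `F = p y' + y v̄'`. Testing with `z' = exp(-2 a x) F`, `z(1) = 0`,
bounds the weighted norm of `F` by a small multiple of that of `y'`; since `p ≥ c`, the converse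
bound holds with a fixed constant up to a small error, so `y' = 0`. -/
theorem eq_zero_of_rep_zero_eq_zero {p : Lp ℝ ∞ μI} {c : ℝ} (hc : 0 < c)
    (hp : ∀ᵐ x ∂μI, c ≤ p x) (s : W21 →L[ℂ] ℂ) {y : W21} (hy0 : rep y 0 = 0)
    (h : ∀ z : W21, rep z 1 = 0 → inner ℂ (D z) (mulLinf p (D y)) + s (mulConj z y) = 0) :
    y = 0 := by
  let v := (InnerProductSpace.toDual ℂ W21).symm s
  have hv : ∀ w, s w = inner ℂ (toL2 v) (toL2 w) + inner ℂ (D v) (D w) := fun w => by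
    rw [← inner_W21, InnerProductSpace.toDual_symm_apply]
  set M := ‖v‖ with hM
  have hM0 : 0 ≤ M := norm_nonneg v
  -- The factor `3` comes from two terms in the bound for `f` and one in the bound for `w`.
  obtain ⟨κ, hκ1, hκ2⟩ : ∃ κ : ℝ, 1 ≤ κ ∧ 3 * (κ⁻¹ * M) < c := by
    refine ⟨1 + 3 * M / c, by rw [le_add_iff_nonneg_right]; positivity, ?_⟩
    have : 0 < 1 + 3 * M / c := by positivity
    rw [inv_mul_eq_div, ← mul_div_assoc, div_lt_iff₀ this, mul_add, mul_div_cancel₀ _ hc.ne']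
    linarith
  have hκ : 0 < κ := by linarith
  have hδ0 : 0 < κ⁻¹ := inv_pos.2 hκ
  have hδ1 : κ⁻¹ ≤ 1 := inv_le_one_of_one_le₀ hκ1
  set a := κ ^ 2 / 2 with ha
  let B := mulBdd (rep y) (3 * ‖y‖) (aesm_rep y) (ae_norm_rep_le y) (star (D v))
  let F : L2I := mulLinf p (D y) + B
  let f := expWeight (-a) F
  let w := expWeight (-a) (D y)
  -- The constant makes `z(1) = 0`. Since `f` already carries the weight once, `z'` carries it
  -- twice, and pairing `z'` with `F` gives exactly `‖f‖²`.
  obtain ⟨z, hzD, hz⟩ := exists_W21_of_D (expWeight (-a) f)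
    (-∫ t in (0 : ℝ)..1, expWeight (-a) f t)
  have hexp : ∀ x, Real.exp (a * x) * Real.exp (-a * x) = 1 := fun x => by
    rw [← Real.exp_add]; simp
  have hyb : ∀ x ∈ Set.Icc (0 : ℝ) 1, ‖rep y x‖ ≤ κ⁻¹ * Real.exp (a * x) * ‖w‖ := fun x hx => by
    have h1 := rep_sub_rep y (a := 0) (b := x) (by simp) hx
    rw [hy0, sub_zero] at h1
    rw [h1]
    exact norm_integral_zero_le_expWeight hκ (D y) hx
  have hzb : ∀ x ∈ Set.Icc (0 : ℝ) 1, ‖rep z x‖ ≤ κ⁻¹ * Real.exp (-a * x) * ‖f‖ := fun x hx => by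
    have h1 : rep z x = -∫ t in x..1, expWeight (-a) f t := by
      rw [hz, ← intervalIntegral.integral_add_adjacent_intervals
        (intervalIntegrable_L2' (expWeight (-a) f) hx)
        ((intervalIntegrable_L2 (expWeight (-a) f)).mono_set (by
          rw [Set.uIcc_of_le hx.2, Set.uIcc_of_le zero_le_one]
          exact Set.Icc_subset_Icc_left hx.1))]
      ring
    rw [h1, norm_neg]
    exact norm_integral_one_expWeight_le hκ f hx
  have hw := expWeight_ae (-a) (D y)
  -- The growth of `y` is at most `exp(a x)` and the decay of `z` at least `exp(-a x)`, so the
  -- weights cancel in the product.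
  have hfst : ‖mulConjFst z y‖ ≤ κ⁻¹ * ‖w‖ * (κ⁻¹ * ‖f‖) := by
    refine norm_L2_le_of_ae_bound _ (by positivity) ?_
    filter_upwards [mulConjFst_ae z y, ae_mem_Icc] with x h1 hx
    rw [h1, norm_mul, RCLike.norm_conj]
    calc ‖rep y x‖ * ‖rep z x‖
        ≤ (κ⁻¹ * Real.exp (a * x) * ‖w‖) * (κ⁻¹ * Real.exp (-a * x) * ‖f‖) := by
          gcongr; exacts [hyb x hx, hzb x hx]
      _ = κ⁻¹ * ‖w‖ * (κ⁻¹ * ‖f‖) * (Real.exp (a * x) * Real.exp (-a * x)) := by ring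
      _ = _ := by rw [hexp, mul_one]
  have hsnd : ‖mulBdd (fun x => conj (rep z x)) (3 * ‖z‖) (aesm_conj_rep z)
      (ae_norm_conj_rep_le z) (D y)‖ ≤ κ⁻¹ * ‖f‖ * ‖w‖ := by
    refine Lp.norm_le_mul_norm_of_ae_le_mul ?_
    filter_upwards [mulBdd_ae _ _ (aesm_conj_rep z) (ae_norm_conj_rep_le z) (D y), hw,
      ae_mem_Icc] with x h1 h2 hx
    rw [h1, h2, norm_mul, norm_mul, RCLike.norm_conj, Complex.norm_real, Real.norm_eq_abs,
      Real.abs_exp]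
    calc ‖rep z x‖ * ‖D y x‖ ≤ (κ⁻¹ * Real.exp (-a * x) * ‖f‖) * ‖D y x‖ := by
          gcongr; exact hzb x hx
      _ = _ := by ring
  have hBw : ‖expWeight (-a) B‖ ≤ κ⁻¹ * ‖w‖ * M := by
    have h1 : ‖expWeight (-a) B‖ ≤ κ⁻¹ * ‖w‖ * ‖star (D v)‖ := by
      refine Lp.norm_le_mul_norm_of_ae_le_mul ?_
      filter_upwards [mulBdd_ae _ _ (aesm_rep y) (ae_norm_rep_le y) (star (D v)),
        expWeight_ae (-a) B, ae_mem_Icc] with x h1 h2 hx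
      rw [h2, h1, norm_mul, norm_mul, Complex.norm_real, Real.norm_eq_abs, Real.abs_exp]
      calc Real.exp (-a * x) * (‖rep y x‖ * ‖(star (D v) : L2I) x‖)
          ≤ Real.exp (-a * x) * ((κ⁻¹ * Real.exp (a * x) * ‖w‖) * ‖(star (D v) : L2I) x‖) := by
            gcongr; exact hyb x hx
        _ = (Real.exp (a * x) * Real.exp (-a * x)) * (κ⁻¹ * ‖w‖ * ‖(star (D v) : L2I) x‖) := by
            ring
        _ = _ := by rw [hexp, one_mul]
    exact h1.trans (by gcongr; exact (norm_star_L2_le _).trans (norm_D_le v))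
  have hlow : c * ‖w‖ ≤ ‖f‖ + κ⁻¹ * ‖w‖ * M := by
    refine (mul_norm_le_norm_mulLinf hc hp w).trans ?_
    have : mulLinf p w = f - expWeight (-a) B := by
      rw [mulLinf_expWeight]
      change _ = expWeight (-a) (mulLinf p (D y) + B) - _
      rw [expWeight_add, add_sub_cancel_right]
    rw [this]
    exact (norm_sub_le _ _).trans (by gcongr)
  have heq := h z (by rw [hz]; simp)
  rw [hv] at heq
  have hDm : D (mulConj z y) = mulBdd (fun x => conj (rep z x)) (3 * ‖z‖) (aesm_conj_rep z)
      (ae_norm_conj_rep_le z) (D y) +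
        mulBdd (rep y) (3 * ‖y‖) (aesm_rep y) (ae_norm_rep_le y) (star (D z)) := rfl
  have hTm : toL2 (mulConj z y) = mulConjFst z y := rfl
  -- Moving `z'` to the other slot by `⟨v', y z̄'⟩ = ⟨z', y v̄'⟩` completes `p y'` to `F`.
  rw [hDm, hTm, inner_add_right, inner_mulBdd_star_comm y (D z) (D v)] at heq
  have hF : inner ℂ (D z) F = (‖f‖ ^ 2 : ℂ) := by
    rw [hzD, inner_expWeight_left]
    exact inner_self_eq_norm_sq_to_K f
  rw [inner_add_right] at hF
  have hup : ‖f‖ ^ 2 ≤ M * (κ⁻¹ * ‖w‖ * (κ⁻¹ * ‖f‖)) + M * (κ⁻¹ * ‖f‖ * ‖w‖) := by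
    have h1 : (‖f‖ ^ 2 : ℂ) = -(inner ℂ (toL2 v) (mulConjFst z y) + inner ℂ (D v)
        (mulBdd (fun x => conj (rep z x)) (3 * ‖z‖) (aesm_conj_rep z)
          (ae_norm_conj_rep_le z) (D y))) := by
      rw [← hF]
      linear_combination heq
    have h2 : ‖f‖ ^ 2 = ‖(‖f‖ ^ 2 : ℂ)‖ := by simp
    rw [h2, h1, norm_neg]
    refine (norm_add_le _ _).trans (add_le_add ?_ ?_)
    · refine (norm_inner_le_norm _ _).trans ?_
      gcongr
      exact norm_toL2_le v
    · refine (norm_inner_le_norm _ _).trans ?_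
      gcongr
      exact norm_D_le v
  have hX : ‖f‖ ≤ 2 * (κ⁻¹ * M) * ‖w‖ := by
    rcases (norm_nonneg f).eq_or_lt with h0 | h0
    · rw [← h0]; positivity
    · refine le_of_mul_le_mul_right ?_ h0
      -- As `κ⁻¹ ≤ 1`, the term of order `κ⁻²` is absorbed in the one of order `κ⁻¹`.
      have h3 : κ⁻¹ * (M * κ⁻¹ * ‖w‖ * ‖f‖) ≤ 1 * (M * κ⁻¹ * ‖w‖ * ‖f‖) := by gcongr
      nlinarith
  have hw0 : ‖w‖ = 0 := by
    by_contra hne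
    have hpos : 0 < ‖w‖ := lt_of_le_of_ne (norm_nonneg w) (Ne.symm hne)
    have : c * ‖w‖ ≤ 3 * (κ⁻¹ * M) * ‖w‖ := by nlinarith
    exact hκ2.not_ge (le_of_mul_le_mul_right this hpos)
  refine ext_rep fun x hx => ?_
  have h1 := hyb x hx
  rw [hw0, mul_zero] at h1
  rw [norm_le_zero_iff.1 h1]
  have : rep (0 : W21) x = 0 := by
    have := rep_smul 0 (0 : W21) hx
    simpa using this
  rw [this]

end SturmLiouville

/-! ### Spectral points and the index on intervals from `ξ`. -/

namespace OperatorPencil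

variable {H : Type*} [NormedAddCommGroup H] [InnerProductSpace ℂ H]

theorem image_eq_realSpectrum_inter_Ioo (A R : H →L[ℂ] H) {ξ x : ℝ} (h : ξ < x) :
    (fun s => ξ + s * (x - ξ)) '' {s : ℝ | s ∈ Set.Ioo 0 1 ∧ ξ + s * (x - ξ) ∈ realSpectrum A R ξ}
      = realSpectrum A R ξ ∩ Set.Ioo ξ x := by
  have h' := sub_pos.2 h
  ext y
  constructor
  · rintro ⟨s, ⟨⟨h0, h1⟩, h2⟩, rfl⟩
    exact ⟨h2, by simp only; nlinarith, by simp only; nlinarith⟩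
  · rintro ⟨h1, h2, h3⟩
    have e : ξ + (y - ξ) / (x - ξ) * (x - ξ) = y := by
      rw [div_mul_cancel₀ _ h'.ne']; ring
    exact ⟨(y - ξ) / (x - ξ), ⟨⟨div_pos (sub_pos.2 h2) h', (div_lt_one h').2 (by linarith)⟩,
      by rwa [e]⟩, e⟩

theorem image_eq_realSpectrum_inter_Ioo' (A R : H →L[ℂ] H) {ξ x : ℝ} (h : x < ξ) :
    (fun s => ξ + s * (x - ξ)) '' {s : ℝ | s ∈ Set.Ioo 0 1 ∧ ξ + s * (x - ξ) ∈ realSpectrum A R ξ}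
      = realSpectrum A R ξ ∩ Set.Ioo x ξ := by
  have h' := sub_pos.2 h
  ext y
  constructor
  · rintro ⟨s, ⟨⟨h0, h1⟩, h2⟩, rfl⟩
    exact ⟨h2, by simp only; nlinarith, by simp only; nlinarith⟩
  · rintro ⟨h1, h2, h3⟩
    have e : ξ + (ξ - y) / (ξ - x) * (x - ξ) = y := by
      rw [← neg_sub ξ x, mul_neg, div_mul_cancel₀ _ h'.ne']; ring
    exact ⟨(ξ - y) / (ξ - x), ⟨⟨div_pos (sub_pos.2 h3) h', (div_lt_one h').2 (by linarith)⟩,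
      by rwa [e]⟩, e⟩

variable {A R : H →L[ℂ] H} {ξ : ℝ}

theorem notMem_realSpectrum (hpos : IsPositiveOperator A) : ξ ∉ realSpectrum A R ξ := by
  refine fun h => h ((Submodule.eq_bot_iff _).2 fun y hy => ?_)
  have hy' : A y = 0 := by simpa using hy
  by_contra hne
  have := hpos y hne
  rw [ContinuousLinearMap.reApplyInnerSelf_apply, hy', inner_zero_left, map_zero] at this
  exact this.false

variable [CompleteSpace H]

theorem finite_and_inertia_of_ne (hA : IsSelfAdjoint A) (hpos : IsPositiveOperator A)
    (hu : IsUnit A) (hR : IsSelfAdjoint R) (hRc : IsCompactOperator R)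
    (h1 : ∀ x : ℝ, Module.finrank ℂ (A - ((x - ξ : ℝ) : ℂ) • R).ker ≤ 1) {x : ℝ} (hx : x ≠ ξ) :
    ((fun s => ξ + s * (x - ξ)) ''
      {s : ℝ | s ∈ Set.Ioo 0 1 ∧ ξ + s * (x - ξ) ∈ realSpectrum A R ξ}).Finite ∧
    inertia (A - ((x - ξ : ℝ) : ℂ) • R) = (((fun s => ξ + s * (x - ξ)) ''
      {s : ℝ | s ∈ Set.Ioo 0 1 ∧ ξ + s * (x - ξ) ∈ realSpectrum A R ξ}).ncard : ℕ∞) := by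
  obtain ⟨h2, h3⟩ := finite_and_inertia_sub_smul hA hpos hu hR hRc h1 (x - ξ)
  have hinj : Function.Injective fun s => ξ + s * (x - ξ) := fun s t hst =>
    mul_right_cancel₀ (sub_ne_zero.2 hx) (add_left_cancel hst)
  exact ⟨h2.image _, by rw [Set.ncard_image_of_injective _ hinj]; exact h3⟩

theorem finite_realSpectrum_inter_Icc (hA : IsSelfAdjoint A) (hpos : IsPositiveOperator A)
    (hu : IsUnit A) (hR : IsSelfAdjoint R) (hRc : IsCompactOperator R)
    (h1 : ∀ x : ℝ, Module.finrank ℂ (A - ((x - ξ : ℝ) : ℂ) • R).ker ≤ 1) (a b : ℝ) :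
    (realSpectrum A R ξ ∩ Set.Icc a b).Finite := by
  -- The interval is enlarged so that its ends lie strictly on either side of `ξ` and the open
  -- pieces cover `[a, b]` apart from `ξ`.
  have hb : ξ < max b ξ + 1 := (le_max_right b ξ).trans_lt (lt_add_one _)
  have ha : min a ξ - 1 < ξ := (sub_one_lt _).trans_le (min_le_right a ξ)
  have e1 := (finite_and_inertia_of_ne hA hpos hu hR hRc h1 hb.ne').1
  have e2 := (finite_and_inertia_of_ne hA hpos hu hR hRc h1 ha.ne).1
  rw [image_eq_realSpectrum_inter_Ioo A R hb] at e1
  rw [image_eq_realSpectrum_inter_Ioo' A R ha] at e2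
  refine (e1.union e2).subset ?_
  rintro y ⟨hy, hya, hyb⟩
  rcases lt_trichotomy y ξ with h | h | h
  · exact Or.inr ⟨hy, by linarith [min_le_left a ξ], h⟩
  · exact absurd (h ▸ hy) (notMem_realSpectrum hpos)
  · exact Or.inl ⟨hy, h, by linarith [le_max_left b ξ]⟩

theorem not_isUnit_iff_mem_realSpectrum (hA : IsSelfAdjoint A) (hpos : IsPositiveOperator A)
    (hu : IsUnit A) (hR : IsSelfAdjoint R) (hRc : IsCompactOperator R) (z : ℂ) :
    ¬ IsUnit (A - (z - ξ) • R) ↔ ∃ x ∈ realSpectrum A R ξ, (x : ℂ) = z := by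
  constructor
  · intro h
    have hk : (A - (z - ξ) • R).ker ≠ ⊥ := fun hk =>
      h (isUnit_sub_of_ker_eq_bot hu (hRc.smul (z - ξ)) hk)
    obtain ⟨y, hy, hy0⟩ := (Submodule.ne_bot_iff _).1 hk
    have hy' : A y = (z - ξ) • R y := sub_eq_zero.1 hy
    obtain ⟨⟨t, ht⟩, -⟩ := exists_real_of_apply_eq_smul hA hpos hR hy0 hy'
    have hz : ((ξ + t : ℝ) : ℂ) = z := by push_cast; rw [ht]; ring
    refine ⟨ξ + t, ?_, hz⟩
    rw [realSpectrum, Set.mem_ofPred_eq, Complex.ofReal_sub, hz]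
    exact hk
  · rintro ⟨x, hx, rfl⟩ h
    rw [realSpectrum, Set.mem_ofPred_eq, Complex.ofReal_sub] at hx
    refine hx (LinearMap.ker_eq_bot.2 ?_)
    exact (ContinuousLinearMap.isUnit_iff_bijective.1 h).1

end OperatorPencil

/-! ### The operators of the boundary problem: symmetry, compactness, invertibility. -/

namespace SturmLiouville

theorem exists_W21_one_sub : ∃ ζ : W21, rep ζ 0 = 1 ∧ rep ζ 1 = 0 := by
  obtain ⟨ζ, -, hζ⟩ := exists_W21_of_D (Lp.const 2 μI (-1 : ℂ)) 1
  refine ⟨ζ, by simp [hζ], ?_⟩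
  rw [hζ, integral_congr_L2 (Lp.coeFn_const 2 μI (-1 : ℂ)) (by simp)]
  simp

/-- The sesquilinear form `(z, y) ↦ ∫₀¹ p y' z̄' dx + ∫₀¹ s y z̄ dx` on `W₂¹[0, 1]`. -/
noncomputable def fullForm (p : Lp ℝ ∞ μI) (s : W21 →L[ℂ] ℂ) : W21 →L⋆[ℂ] W21 →L[ℂ] ℂ :=
  ((innerSL ℂ).bilinearComp D (mulLinf p ∘L D) : W21 →L⋆[ℂ] W21 →L[ℂ] ℂ)
    + (s.postcomp W21) ∘SL mulConjL

theorem fullForm_apply (p : Lp ℝ ∞ μI) (s : W21 →L[ℂ] ℂ) (z y : W21) :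
    fullForm p s z y = inner ℂ (D z) (mulLinf p (D y)) + s (mulConj z y) := rfl

variable (U : Matrix (Fin 2) (Fin 2) ℂ)

/-- The functional `w ↦ ∫₀¹ q w dx + V₁₁ w(0) + V₂₂ w(1)`, which carries the boundary terms. -/
noncomputable def addBoundary (q : W21 →L[ℂ] ℂ) : W21 →L[ℂ] ℂ :=
  q + ∑ k, (V U k : ℂ) • (ContinuousLinearMap.proj k ∘L trace)

theorem trace_mulConj (z y : W21) (k : Fin 2) :
    trace (mulConj z y) k = inner ℂ (trace z k) (trace y k) := by
  fin_cases k
  · exact rep_mulConj z y (by simp)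
  · exact rep_mulConj z y (by simp)

/-- A boundary term is a point mass at an endpoint evaluated on `y z̄`. Point masses are functionals
on `W₂¹`, so `V` is absorbed into `q` and needs no separate treatment. -/
theorem mainForm_apply (p : Lp ℝ ∞ μI) (q : W21 →L[ℂ] ℂ) (z y : HU U) :
    mainForm U p q z y = fullForm p (addBoundary U q) (incl U z) (incl U y) := by
  rw [fullForm_apply]
  have h1 : addBoundary U q (mulConj (incl U z) (incl U y)) = q (mulConj (incl U z) (incl U y))
      + ∑ k, (V U k : ℂ) * inner ℂ (trace (incl U z) k) (trace (incl U y) k) := by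
    simp only [← trace_mulConj]
    simp only [addBoundary, add_apply, sum_apply, smul_apply, smul_eq_mul]
    rfl
  rw [h1]
  simp only [mainForm, ContinuousLinearMap.bilinearComp_apply, add_apply, sum_apply, smul_apply]
  exact add_assoc _ _ _

theorem iPlusPencil_eq (p : Lp ℝ ∞ μI) (q r : W21 →L[ℂ] ℂ) (lam : ℂ) :
    iPlusPencil U p q r lam = opOf U (mainForm U p q) - lam • opOf U (weightForm U r) := by
  ext y
  simp [iPlusPencil, pencil]

theorem inner_iPlusPencil_apply (p : Lp ℝ ∞ μI) (q r : W21 →L[ℂ] ℂ) (lam : ℂ) (z y : HU U) :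
    inner ℂ z (iPlusPencil U p q r lam y)
      = fullForm p (addBoundary U q - lam • r) (incl U z) (incl U y) := by
  have h5 : weightForm U r z y = r (mulConj (incl U z) (incl U y)) := rfl
  rw [iPlusPencil_eq, sub_apply, smul_apply, inner_sub_right, inner_smul_right, inner_opOf,
    inner_opOf, mainForm_apply, fullForm_apply, fullForm_apply, h5, sub_apply, smul_apply,
    smul_eq_mul]
  ring

theorem isRealFunctional_addBoundary {q : W21 →L[ℂ] ℂ} (hq : IsRealFunctional q) :
    IsRealFunctional (addBoundary U q) := by
  intro y hy
  have h0 : (trace y 0).im = 0 := hy 0 (by simp)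
  have h1 : (trace y 1).im = 0 := hy 1 (by simp)
  have h2 : addBoundary U q y = q y + ((V U 0 : ℂ) * trace y 0 + (V U 1 : ℂ) * trace y 1) := by
    simp only [addBoundary, add_apply, smul_apply, smul_eq_mul, Fin.sum_univ_two]
    rfl
  rw [h2]
  simp [hq y hy, h0, h1]

theorem inner_mulLinf_comm (p : Lp ℝ ∞ μI) (f g : L2I) :
    inner ℂ (mulLinf p f) g = inner ℂ f (mulLinf p g) := by
  rw [L2.inner_def, L2.inner_def]
  refine integral_congr_ae ?_
  filter_upwards [mulLinf_ae p f, mulLinf_ae p g] with x h1 h2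
  rw [h1, h2, RCLike.inner_apply, RCLike.inner_apply, map_mul]
  rw [show (starRingEnd ℂ) ((p x : ℝ) : ℂ) = (p x : ℂ) from Complex.conj_ofReal _]
  ring

theorem fullForm_comm (p : Lp ℝ ∞ μI) {s : W21 →L[ℂ] ℂ} (hs : IsRealFunctional s) (z y : W21) :
    fullForm p s y z = conj (fullForm p s z y) := by
  rw [fullForm_apply, fullForm_apply, map_add, ← hs.apply_mulConj_comm, inner_conj_symm,
    inner_mulLinf_comm]

theorem isSelfAdjoint_opOf {B : HU U →L⋆[ℂ] HU U →L[ℂ] ℂ} (hB : ∀ z y, B y z = conj (B z y)) :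
    IsSelfAdjoint (opOf U B) := by
  refine ContinuousLinearMap.isSelfAdjoint_iff_isSymmetric.2 fun y z => ?_
  simp only [ContinuousLinearMap.coe_coe]
  rw [← inner_conj_symm, inner_opOf, inner_opOf, hB y z]
  simp

theorem isSelfAdjoint_opOf_mainForm (p : Lp ℝ ∞ μI) {q : W21 →L[ℂ] ℂ}
    (hq : IsRealFunctional q) : IsSelfAdjoint (opOf U (mainForm U p q)) :=
  isSelfAdjoint_opOf U fun z y => by
    rw [mainForm_apply, mainForm_apply, fullForm_comm p (isRealFunctional_addBoundary U hq)]

theorem isSelfAdjoint_opOf_weightForm {r : W21 →L[ℂ] ℂ} (hr : IsRealFunctional r) :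
    IsSelfAdjoint (opOf U (weightForm U r)) :=
  isSelfAdjoint_opOf U fun z y => hr.apply_mulConj_comm (incl U z) (incl U y)

theorem isCompactOperator_of_inner_le (T : HU U →L[ℂ] HU U)
    (h : ∀ ε > 0, ∃ C, 0 ≤ C ∧ ∀ z y,
      ‖inner ℂ z (T y)‖ ≤ (ε * ‖y‖ + C * ‖embI U y‖) * ‖z‖) : IsCompactOperator T := by
  refine isCompactOperator_of_forall_norm_le T fun ε hε => ?_
  obtain ⟨C, hC, hT⟩ := h ε hε
  refine ⟨L2I, inferInstance, inferInstance, (C : ℂ) • embI U,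
    (isCompactOperator_toL2.comp_clm (incl U)).smul (C : ℂ), fun y => ?_⟩
  have h1 := hT (T y) y
  have h2 : ‖((C : ℂ) • embI U) y‖ = C * ‖embI U y‖ := by
    rw [smul_apply, norm_smul, Complex.norm_real, Real.norm_of_nonneg hC]
  rw [h2]
  rcases (norm_nonneg (T y)).eq_or_lt with h0 | h0
  · rw [← h0]; positivity
  · refine le_of_mul_le_mul_right ?_ h0
    rw [inner_self_eq_norm_sq_to_K] at h1
    have h3 : ‖((‖T y‖ : ℝ) : ℂ) ^ 2‖ = ‖T y‖ * ‖T y‖ := by simp [sq]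
    exact h3 ▸ h1

theorem isCompactOperator_opOf_weightForm (r : W21 →L[ℂ] ℂ) :
    IsCompactOperator (opOf U (weightForm U r)) := by
  refine isCompactOperator_of_inner_le U _ fun ε hε => ?_
  obtain ⟨C, hC, h⟩ := exists_norm_mulConj_le r hε
  exact ⟨C, hC, fun z y => by rw [inner_opOf]; exact h (incl U z) (incl U y)⟩

theorem re_inner_mulLinf_self_ge {p : Lp ℝ ∞ μI} {c : ℝ} (hp : ∀ᵐ x ∂μI, c ≤ p x) (g : L2I) :
    c * ‖g‖ ^ 2 ≤ RCLike.re (inner ℂ g (mulLinf p g)) := by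
  rw [← inner_self_eq_norm_sq (𝕜 := ℂ), L2.inner_def, L2.inner_def,
    ← integral_re (L2.integrable_inner g g), ← integral_re (L2.integrable_inner g (mulLinf p g)),
    ← integral_const_mul]
  refine integral_mono_ae ((L2.integrable_inner g g).re.const_mul c)
    (L2.integrable_inner g (mulLinf p g)).re ?_
  filter_upwards [hp, mulLinf_ae p g] with x h1 h2
  have h3 : inner ℂ (g x) (mulLinf p g x) = (p x : ℂ) * inner ℂ (g x) (g x) := by
    rw [h2, ← smul_eq_mul (p x : ℂ), inner_smul_right]
  rw [h3, inner_self_eq_norm_sq_to_K]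
  have h4 : RCLike.re ((p x : ℂ) * ((‖g x‖ : ℝ) : ℂ) ^ 2) = p x * ‖g x‖ ^ 2 := by
    norm_cast
  have h5 : RCLike.re (((‖g x‖ : ℝ) : ℂ) ^ 2) = ‖g x‖ ^ 2 := by norm_cast
  refine (mul_le_mul_of_nonneg_right h1 (sq_nonneg ‖g x‖)).trans' ?_ |>.trans ?_
  · exact (congrArg (c * ·) h5).le
  · exact h4.ge

/-- Positivity alone gives only a trivial kernel. Invertibility follows because the operator differs
by a compact one from `P`, the operator of `∫ p y' z̄' + ∫ y z̄`, which is coercive with constant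
`min c 1`. -/
theorem isUnit_iPlusPencil_of_isPositiveOperator {p : Lp ℝ ∞ μI} {c : ℝ} (hc : 0 < c)
    (hp : ∀ᵐ x ∂μI, c ≤ p x) (q r : W21 →L[ℂ] ℂ) (lam : ℂ)
    (hpos : OperatorPencil.IsPositiveOperator (iPlusPencil U p q r lam)) :
    IsUnit (iPlusPencil U p q r lam) := by
  let d : HU U →L[ℂ] L2I := D ∘L incl U
  let P : HU U →L[ℂ] HU U := d.adjoint ∘L mulLinf p ∘L d + (embI U).adjoint ∘L embI U
  have hP : ∀ z y, inner ℂ z (P y)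
      = inner ℂ (d z) (mulLinf p (d y)) + inner ℂ (embI U z) (embI U y) := fun z y => by
    change inner ℂ z (d.adjoint (mulLinf p (d y)) + (embI U).adjoint (embI U y)) = _
    rw [inner_add_right, ContinuousLinearMap.adjoint_inner_right,
      ContinuousLinearMap.adjoint_inner_right]
  have hPu : IsUnit P := by
    refine ContinuousLinearMap.isUnit_of_forall_le_norm_inner_map P
      (c := ⟨min c 1, (lt_min hc one_pos).le⟩) (lt_min hc one_pos) fun y => ?_
    rw [norm_inner_symm, hP]
    refine le_trans ?_ (RCLike.re_le_norm _)
    have h1 := re_inner_mulLinf_self_ge hp (d y)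
    have h2 : ‖y‖ ^ 2 = ‖embI U y‖ ^ 2 + ‖d y‖ ^ 2 := norm_sq_W21 (incl U y)
    rw [map_add, inner_self_eq_norm_sq, h2]
    change _ * min c 1 ≤ _
    have h3 : ‖d y‖ ^ 2 * min c 1 ≤ ‖d y‖ ^ 2 * c := by gcongr; exact min_le_left _ _
    have h4 : ‖embI U y‖ ^ 2 * min c 1 ≤ ‖embI U y‖ ^ 2 * 1 := by gcongr; exact min_le_right _ _
    linarith
  have hC : IsCompactOperator (P - iPlusPencil U p q r lam) := by
    refine isCompactOperator_of_inner_le U _ fun ε hε => ?_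
    obtain ⟨C, hC, h⟩ := exists_norm_mulConj_le (addBoundary U q - lam • r) hε
    refine ⟨C + 1, by positivity, fun z y => ?_⟩
    have h1 : inner ℂ z ((P - iPlusPencil U p q r lam) y) = inner ℂ (embI U z) (embI U y)
        - (addBoundary U q - lam • r) (mulConj (incl U z) (incl U y)) := by
      rw [sub_apply, inner_sub_right, hP, inner_iPlusPencil_apply, fullForm_apply]
      exact add_sub_add_left_eq_sub _ _ _
    rw [h1]
    have h2 : ‖embI U z‖ ≤ ‖z‖ := norm_toL2_le (incl U z)
    calc _ ≤ ‖embI U z‖ * ‖embI U y‖ + (ε * ‖y‖ + C * ‖embI U y‖) * ‖z‖ :=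
          (norm_sub_le _ _).trans (add_le_add (norm_inner_le_norm _ _) (h (incl U z) (incl U y)))
      _ ≤ ‖z‖ * ‖embI U y‖ + (ε * ‖y‖ + C * ‖embI U y‖) * ‖z‖ := by gcongr
      _ = _ := by ring
  have := OperatorPencil.isUnit_sub_of_ker_eq_bot hPu hC
  rw [sub_sub_cancel] at this
  refine this ((Submodule.eq_bot_iff _).2 fun y hy => ?_)
  have hy' : iPlusPencil U p q r lam y = 0 := hy
  by_contra hne
  have := hpos y hne
  rw [ContinuousLinearMap.reApplyInnerSelf_apply, hy', inner_zero_left, map_zero] at this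
  exact this.false

/-! ### Geometric simplicity of the eigenvalues. -/

variable {U}

/-- For diagonal `U` the conditions separate: a Dirichlet condition at each end with `U_kk = 1`, and
no constraint at the other. -/
theorem mem_boundarySubspace_iff (hU : U.IsDiag) {w : W21} :
    w ∈ boundarySubspace U ↔ ∀ k, U k k = 1 → trace w k = 0 := by
  have hmv : ∀ (u : Fin 2 → ℂ) k, (U - 1).mulVecLin u k = (U k k - 1) * u k := fun u k => by
    have h := hU.diagonal_diag
    rw [Matrix.mulVecLin_apply, ← h, ← Matrix.diagonal_one, Matrix.diagonal_sub,
      Matrix.mulVec_diagonal]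
    simp
  constructor
  · rintro ⟨u, hu⟩ k hk
    have := congrFun hu k
    rw [hmv, hk, sub_self, zero_mul] at this
    exact this.symm
  · intro h
    refine ⟨fun k => (U k k - 1)⁻¹ * trace w k, ?_⟩
    ext k
    rw [hmv]
    by_cases hk : U k k = 1
    · rw [hk, sub_self, zero_mul]; exact (h k hk).symm
    · rw [mul_inv_cancel_left₀ (sub_ne_zero.2 hk)]; rfl

/-- A solution is determined by its Cauchy data at `0`, one of which the boundary condition there
fixes; the other is the injective functional. With `ζ(0) = 1` and `ζ(1) = 0`, the value `B(ζ, y)`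
plays the role of the quasi-derivative datum. -/
theorem exists_injective_ker_iPlusPencil (hU : U.IsDiag) {p : Lp ℝ ∞ μI} {c : ℝ} (hc : 0 < c)
    (hp : ∀ᵐ x ∂μI, c ≤ p x) (q r : W21 →L[ℂ] ℂ) (lam : ℂ) :
    ∃ f : (iPlusPencil U p q r lam).ker →ₗ[ℂ] ℂ, Function.Injective f := by
  obtain ⟨ζ, hζ0, hζ1⟩ := exists_W21_one_sub
  set B := fullForm p (addBoundary U q - lam • r) with hB
  -- In the Dirichlet case `y(0) = 0` is given and `B(ζ, y)` is free. Otherwise `ζ` is an admissible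
  -- test function, so `B(ζ, y) = 0` is given and `y(0)` is free.
  let ℓ : W21 →L[ℂ] ℂ := if U 0 0 = 1 then B ζ else evalAt ⟨0, by simp⟩
  let ℓ' : (iPlusPencil U p q r lam).ker →ₗ[ℂ] ℂ :=
    (ℓ ∘L incl U : HU U →L[ℂ] ℂ).toLinearMap.domRestrict _
  refine ⟨ℓ', ?_⟩
  rw [injective_iff_map_eq_zero]
  rintro ⟨y, hy⟩ hℓ
  replace hℓ : ℓ (incl U y) = 0 := hℓ
  have hy' : iPlusPencil U p q r lam y = 0 := hy
  have hBz : ∀ w ∈ boundarySubspace U, B w (incl U y) = 0 := fun w hw => by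
    obtain ⟨w, rfl⟩ : ∃ w' : HU U, incl U w' = w := ⟨⟨w, hw⟩, rfl⟩
    have := inner_iPlusPencil_apply U p q r lam w y
    rw [hy', inner_zero_right] at this
    exact this.symm
  have hkey : rep (incl U y) 0 = 0 ∧ B ζ (incl U y) = 0 := by
    by_cases h : U 0 0 = 1
    · refine ⟨(mem_boundarySubspace_iff hU).1 (incl_mem U y) 0 h, ?_⟩
      simpa only [ℓ, if_pos h] using hℓ
    · refine ⟨?_, hBz ζ ((mem_boundarySubspace_iff hU).2 fun k hk => ?_)⟩
      · simp only [ℓ, if_neg h] at hℓ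
        exact hℓ
      · fin_cases k
        · exact absurd hk h
        · exact hζ1
  have h0 : incl U y = 0 := by
    refine eq_zero_of_rep_zero_eq_zero hc hp (addBoundary U q - lam • r) hkey.1 fun z hz => ?_
    -- Subtracting `z(0) ζ` makes both end values zero, hence the test function is admissible for
    -- every diagonal `U`.
    have hz0 : z + (-rep z 0) • ζ ∈ boundarySubspace U := by
      refine (mem_boundarySubspace_iff hU).2 fun k _ => ?_
      rw [map_add, map_smul, Pi.add_apply, Pi.smul_apply, smul_eq_mul]
      fin_cases k
      · change rep z 0 + -rep z 0 * rep ζ 0 = 0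
        rw [hζ0]; ring
      · change rep z 1 + -rep z 0 * rep ζ 1 = 0
        rw [hζ1, hz]; ring
    have h1 := hBz _ hz0
    rw [map_add, add_apply, map_smulₛₗ, smul_apply, hkey.2, smul_zero, add_zero] at h1
    exact h1
  exact Subtype.ext (incl_injective U (h0.trans (map_zero (incl U)).symm))

/-! ### Passage between `T` and `I⁺T`, and absence of associated vectors. -/

theorem iPlus_pencil_apply (p : Lp ℝ ∞ μI) (q r : W21 →L[ℂ] ℂ) (lam : ℂ) (y : HU U) :
    iPlus U (pencil U p q r lam y) = iPlusPencil U p q r lam y := rfl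

theorem ker_pencil (p : Lp ℝ ∞ μI) (q r : W21 →L[ℂ] ℂ) (lam : ℂ) :
    (pencil U p q r lam).ker = (iPlusPencil U p q r lam).ker := by
  ext y
  change pencil U p q r lam y = 0 ↔ iPlusPencil U p q r lam y = 0
  rw [← iPlus_pencil_apply, map_eq_zero_iff _ (iPlus U).injective]

theorem isInvertible_pencil_iff (p : Lp ℝ ∞ μI) (q r : W21 →L[ℂ] ℂ) (lam : ℂ) :
    (pencil U p q r lam).IsInvertible ↔ IsUnit (iPlusPencil U p q r lam) := by
  have h1 : (iPlusPencil U p q r lam).IsInvertible ↔ (pencil U p q r lam).IsInvertible :=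
    ContinuousLinearMap.isInvertible_equiv_comp (e := (iPlus U).toContinuousLinearEquiv)
  rw [← h1]
  constructor
  · rintro ⟨e, he⟩
    rw [← he, ContinuousLinearMap.isUnit_iff_bijective]
    exact e.bijective
  · rintro ⟨u, hu⟩
    exact ⟨ContinuousLinearEquiv.unitsEquiv ℂ (HU U) u, hu⟩

theorem isSelfAdjoint_iPlusPencil (p : Lp ℝ ∞ μI) {q r : W21 →L[ℂ] ℂ} (hq : IsRealFunctional q)
    (hr : IsRealFunctional r) (x : ℝ) : IsSelfAdjoint (iPlusPencil U p q r (x : ℂ)) := by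
  rw [iPlusPencil_eq, isSelfAdjoint_iff, star_sub, star_smul,
    (isSelfAdjoint_opOf_mainForm U p hq).star_eq, (isSelfAdjoint_opOf_weightForm U hr).star_eq]
  simp

theorem iPlusPencil_eq_sub (p : Lp ℝ ∞ μI) (q r : W21 →L[ℂ] ℂ) (ξ : ℝ) (lam : ℂ) :
    iPlusPencil U p q r lam
      = iPlusPencil U p q r (ξ : ℂ) - (lam - ξ) • opOf U (weightForm U r) := by
  rw [iPlusPencil_eq, iPlusPencil_eq, sub_smul]
  abel

/-- An associated vector satisfies `I⁺T(x) z = R y`. Symmetry then gives `⟨Ry, y⟩ = ⟨z, I⁺T(x) y⟩ =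
0`, contrary to the positivity at `ξ`. -/
theorem isSimpleEigenvalue_pencil {p : Lp ℝ ∞ μI} {q r : W21 →L[ℂ] ℂ} (hq : IsRealFunctional q)
    (hr : IsRealFunctional r) {ξ x : ℝ}
    (hξ : OperatorPencil.IsPositiveOperator (iPlusPencil U p q r (ξ : ℂ)))
    (hf : ∃ f : (iPlusPencil U p q r x).ker →ₗ[ℂ] ℂ, Function.Injective f)
    (hx : (iPlusPencil U p q r x).ker ≠ ⊥) :
    OperatorPencil.IsSimpleEigenvalue (pencil U p q r) (x : ℂ) := by
  refine ⟨?_, fun y hy hy0 z hz => ?_⟩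
  · rw [ker_pencil]
    obtain ⟨f, hf⟩ := hf
    have := FiniteDimensional.of_injective f hf
    refine le_antisymm (by simpa using LinearMap.finrank_le_finrank_of_injective hf) ?_
    exact Submodule.one_le_finrank_iff.2 hx
  · rw [(hasDerivAt_pencil U p q r x).deriv] at hz
    have hXy : iPlusPencil U p q r x y = 0 := by rw [← iPlus_pencil_apply, hy, map_zero]
    have h1 : iPlusPencil U p q r x z = opOf U (weightForm U r) y := by
      have h2 := congrArg (iPlus U) hz
      rw [map_add, map_zero, iPlus_pencil_apply, neg_apply, map_neg, ← sub_eq_add_neg,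
        sub_eq_zero] at h2
      rw [h2]
      exact (iPlus U).apply_symm_apply _
    have h3 : inner ℂ y (opOf U (weightForm U r) y) = 0 := by
      rw [← h1]
      refine ((isSelfAdjoint_iPlusPencil p hq hr x).isSymmetric y z).symm.trans ?_
      simp [hXy]
    rw [iPlusPencil_eq_sub p q r ξ, sub_apply, smul_apply, sub_eq_zero] at hXy
    exact (OperatorPencil.exists_real_of_apply_eq_smul (isSelfAdjoint_iPlusPencil p hq hr ξ) hξ
      (isSelfAdjoint_opOf_weightForm U hr) hy0 hXy).2 h3

end SturmLiouville

/-! ### Assembly of the theorem. -/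

open SturmLiouville OperatorPencil

theorem mainTheorem1 (p : Lp ℝ ∞ SturmLiouville.μI)
    (hp : ∃ c : ℝ, 0 < c ∧ ∀ᵐ x ∂SturmLiouville.μI, c ≤ p x)
    (q r : SturmLiouville.W21 →L[ℂ] ℂ)
    (hq : SturmLiouville.IsRealFunctional q) (hr : SturmLiouville.IsRealFunctional r)
    (U : Matrix (Fin 2) (Fin 2) ℂ) (hU : U ∈ Matrix.unitaryGroup (Fin 2) ℂ) (hUd : U.IsDiag)
    (ξ : ℝ)
    (hξ : OperatorPencil.IsPositiveOperator (SturmLiouville.iPlusPencil U p q r (ξ : ℂ))) :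
    ∃ (Nneg Npos : ℕ∞) (lam : ℤ → ℝ) (J : Set ℤ),
      J = {n : ℤ | (0 < n ∧ (n.natAbs : ℕ∞) ≤ Npos) ∨ (n < 0 ∧ (n.natAbs : ℕ∞) ≤ Nneg)} ∧
      OperatorPencil.spectrum (SturmLiouville.pencil U p q r) = (fun n => (lam n : ℂ)) '' J ∧
      StrictMonoOn lam J ∧
      (∀ n ∈ J, 0 < n → ξ < lam n) ∧
      (∀ n ∈ J, n < 0 → lam n < ξ) ∧
      (∀ x : ℝ, ¬ AccPt x (Filter.principal (lam '' J))) ∧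
      (∀ n ∈ J, OperatorPencil.IsSimpleEigenvalue (SturmLiouville.pencil U p q r) (lam n : ℂ)) ∧
      (∀ n ∈ J, OperatorPencil.inertia (SturmLiouville.iPlusPencil U p q r (lam n : ℂ))
        = ((n.natAbs - 1 : ℕ) : ℕ∞)) := by
  obtain ⟨c, hc, hp⟩ := hp
  set A := iPlusPencil U p q r (ξ : ℂ) with hA
  set R := opOf U (weightForm U r) with hR
  have hX : ∀ lam, iPlusPencil U p q r lam = A - (lam - ξ) • R := iPlusPencil_eq_sub p q r ξ
  have hXr : ∀ x : ℝ, iPlusPencil U p q r (x : ℂ) = A - ((x - ξ : ℝ) : ℂ) • R := fun x => by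
    rw [hX, Complex.ofReal_sub]
  have hAs : IsSelfAdjoint A := isSelfAdjoint_iPlusPencil p hq hr ξ
  have hRs : IsSelfAdjoint R := isSelfAdjoint_opOf_weightForm U hr
  have hRc : IsCompactOperator R := isCompactOperator_opOf_weightForm U r
  have hAu : IsUnit A := isUnit_iPlusPencil_of_isPositiveOperator U hc hp q r ξ hξ
  have hf := exists_injective_ker_iPlusPencil hUd hc hp q r
  have h1 : ∀ x : ℝ, Module.finrank ℂ (A - ((x - ξ : ℝ) : ℂ) • R).ker ≤ 1 := fun x => by
    rw [← hXr]
    obtain ⟨f, hf⟩ := hf x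
    simpa using LinearMap.finrank_le_finrank_of_injective hf
  have hfin := finite_realSpectrum_inter_Icc hAs hξ hAu hRs hRc h1
  obtain ⟨Nneg, Npos, lam, J, hJ, himg, hmono, hpos, hneg⟩ :=
    exists_two_sided_enumeration (notMem_realSpectrum hξ) hfin
  refine ⟨Nneg, Npos, lam, J, hJ, ?_, hmono, fun n hn h => (hpos n hn h).1,
    fun n hn h => (hneg n hn h).1, ?_, fun n hn => ?_, fun n hn => ?_⟩
  · rw [← Set.image_image (fun x : ℝ => (x : ℂ)) lam, himg]
    ext z
    change ¬ (pencil U p q r z).IsInvertible ↔ _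
    rw [isInvertible_pencil_iff, hX]
    exact not_isUnit_iff_mem_realSpectrum hAs hξ hAu hRs hRc z
  · rw [himg]
    exact not_accPt_of_finite_inter_Icc hfin
  · have hmem : lam n ∈ realSpectrum A R ξ := himg ▸ ⟨n, hn, rfl⟩
    exact isSimpleEigenvalue_pencil hq hr hξ (hf _) (by rw [hXr]; exact hmem)
  · rw [hXr]
    rcases lt_trichotomy n 0 with h | h | h
    · obtain ⟨h2, h3⟩ := hneg n hn h
      rw [(finite_and_inertia_of_ne hAs hξ hAu hRs hRc h1 h2.ne).2,
        image_eq_realSpectrum_inter_Ioo' A R h2, h3]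
    · rw [hJ] at hn
      rcases hn with hn | hn <;> omega
    · obtain ⟨h2, h3⟩ := hpos n hn h
      rw [(finite_and_inertia_of_ne hAs hξ hAu hRs hRc h1 h2.ne').2,
        image_eq_realSpectrum_inter_Ioo A R h2, h3]
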